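/- Throughout, \(\mathbb N=\{1,2,\dots\}\) and spaces are real. Let \(X\) be a Banach space with a (Schauder) basis \((e_i)_{i\in\mathbb N}\). For nonempty finite sets \(F,G\subseteq\mathbb N\) write \(F<G\) if \(\max F<\min G\). For a sequence \((x_i)\), a block sequence of \((x_i)\) is a (finite or infinite) sequence of nonzero finite linear combinations \(y_1,y_2,\dots\) of the \(x_i\) with \(\operatorname{supp}y_1<\operatorname{supp}y_2<\cdots\), supports being taken with respect to \((x_i)\); a block basis \((y_i)\prec(x_i)\) is an infinite block sequence. The space \(X\) is *asymptotic \(\ell_1\)* (with respect to \((e_i)\)) if there is \(C>0\) such that \(\|\sum_{i=1}^n x_i\|\ge\frac1C\sum_{i=1}^n\|x_i\|\) for all \(n\in\mathbb N\) and all block sequences \(x_1,\dots,x_n\) of \((e_i)\) with \(\operatorname{supp}x_1\subseteq[n,\infty)\). It *contains \(\ell_1\)* if some subspace of \(X\) is linearly homeomorphic to \(\ell_1\). *Schreier families.* For sets \(\mathcal F,\mathcal G\) of finite subsets of \(\mathbb N\) let \(\mathcal F[\mathcal G]\) be the set of all unions \(G_1\cup\dots\cup G_k\) (\(k\ge0\))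 of nonempty sets \(G_1<\dots<G_k\) in \(\mathcal G\) with \(\{\min G_1,\dots,\min G_k\}\in\mathcal F\). Put \(\mathcal S_0=\{\emptyset\}\cup\{\{n\}:n\in\mathbb N\}\), \(\mathcal S_1=\{\emptyset\}\cup\{F:|F|\le\min F\}\), \(\mathcal S_{\alpha+1}=\mathcal S_1[\mathcal S_\alpha]\), and for every limit ordinal \(\alpha<\omega_1\) fix a strictly increasing sequence \(\alpha_n\uparrow\alpha\) and put \(\mathcal S_\alpha=\{F: F\in\mathcal S_{\alpha_n}\text{ and }F\subseteq[n,\infty)\text{ for some }n\in\mathbb N\}\). *Constants.* For an equivalent norm \(|\cdot|\) on \(X\), a block basis \((x_i)\prec(e_i)\) and \(\alpha<\omega_1\), let \(\delta_\alpha((x_i),|\cdot|)\) be the supremum of all \(\delta\ge0\) such that \(|\sum_{i=1}^k y_i|\ge\delta\sum_{i=1}^k|y_i|\) for all finite block sequences \(y_1,\dots,y_k\) of \((x_i)\) with \(\{\min\operatorname{supp}y_i:i\le k\}\in\mathcal S_\alpha\), supports being taken with respect to \((x_i)\). Let \[\ddot\delta_\alpha(X)=\sup\{\delta_\alpha((x_i),|\cdot|):(x_i)\prec(e_i),\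 |\cdot|\text{ an equivalent norm on }X\},\qquad I_\Delta(X)=\inf\{\alpha<\omega_1:\ddot\delta_\alpha(X)<1\}.\] **Theorem.** Let \(X\) be asymptotic \(\ell_1\) with respect to its basis \((e_i)\), and suppose that \(X\) does not contain \(\ell_1\). Then, for any choice of the sequences \(\alpha_n\uparrow\alpha\) above, \(I_\Delta(X)=\omega^\alpha\) for some \(\alpha<\omega_1\). Moreover, if \(I_\Delta(X)=\alpha_0\) and \(\ddot\delta_{\alpha_0}(X)=\theta\), then \(\ddot\delta_{\alpha_0\cdot n+\beta}(X)=\theta^n\) for all integers \(n\ge0\) and all \(\beta<\alpha_0\) (with \(\theta^0=1\)), and \(\ddot\delta_\beta(X)=0\) for all \(\alpha_0\cdot\omega\le\beta<\omega_1\). -/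

import Mathlib

open Ordinal

noncomputable section

namespace AsymptoticL1

/-!
Indexing convention: a sequence `e_1, e_2, …` indexed by the positive integers is represented by
`e : ℕ → X` with `e i` in the role of `e_{i+1}`; a set `F` of positive integers is represented by
`{i : ℕ | i + 1 ∈ F}`.
-/

/-! ### Schreier families -/

/-- The minimum of a (nonempty) finite set of natural numbers. -/
def minOf (E : Finset ℕ) : ℕ := sInf (E : Set ℕ)

/-- `E_1 < E_2 < ⋯`: the sets are nonempty, and every element of an earlier set is smaller than
every element of a later one. -/
def Successive {ι : Type} [LT ι] (E : ι → Finset ℕ) : Prop :=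
  (∀ i, (E i).Nonempty) ∧ ∀ i j, i < j → ∀ m ∈ E i, ∀ n ∈ E j, m < n

/-- `F[G]`: the unions `⋃ G_i` of finitely many successive members of `G` such that the set of the
minima of the `G_i` belongs to `F`. -/
def comp (F G : Set (Finset ℕ)) : Set (Finset ℕ) :=
  {A | ∃ (k : ℕ) (E : Fin k → Finset ℕ), Successive E ∧ (∀ i, E i ∈ G) ∧
    Finset.univ.image (fun i => minOf (E i)) ∈ F ∧ A = Finset.univ.biUnion E}

/-- `S_0`: the empty set and the singletons. -/
def schreierZero : Set (Finset ℕ) := {F | F.card ≤ 1}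

/-- `S_1`: the sets `F` of positive integers with `|F| ≤ min F`, and the empty set
(`i : ℕ` stands for the positive integer `i + 1`). -/
def schreierOne : Set (Finset ℕ) := {F | ∀ i ∈ F, F.card ≤ i + 1}

/-- A choice, for every countable limit ordinal `α`, of a strictly increasing sequence of ordinals
with supremum `α`. -/
def IsLadderSystem (a : Ordinal.{0} → ℕ → Ordinal.{0}) : Prop :=
  ∀ α, α < ω₁ → Order.IsSuccLimit α → StrictMono (a α) ∧ (∀ n, a α n < α) ∧
    IsLUB (Set.range (a α)) α

/-- The Schreier family `S_α` built from the ladder system `a`: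
`S_{α+1} = S_1[S_α]`, and for a limit ordinal `α` a set `F` belongs to `S_α` iff for some `n` it
belongs to `S_{a α n}` and has all its elements at least `n`. -/
def schreier (a : Ordinal.{0} → ℕ → Ordinal.{0}) (α : Ordinal.{0}) : Set (Finset ℕ) :=
  Ordinal.limitRecOn (motive := fun _ => Set (Finset ℕ)) α
    schreierZero
    (fun _ S => comp schreierOne S)
    (fun β _ S => {F | ∃ (n : ℕ) (h : a β n < β), F ∈ S (a β n) h ∧ ∀ i ∈ F, n ≤ i})

/-! ### Blocks and asymptotic constants -/

section Constants

variable {X : Type*} [NormedAddCommGroup X] [NormedSpace ℝ X]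

/-- The coefficient vectors `c_i` are nonzero and have successive supports. -/
def SuccessiveVectors {ι : Type} [LT ι] (c : ι → ℕ →₀ ℝ) : Prop :=
  Successive fun i => (c i).support

/-- The finite linear combination `∑ j, c j • x j`. -/
def comb (x : ℕ → X) (c : ℕ →₀ ℝ) : X := Finsupp.linearCombination ℝ x c

/-- `(y_i) ≺ (x_i)`: `y` is an (infinite) block basis of `x`. -/
def IsBlockBasis (x y : ℕ → X) : Prop :=
  ∃ c : ℕ → ℕ →₀ ℝ, SuccessiveVectors c ∧ ∀ i, y i = comb x (c i)

/-- The finite block sequence with coefficient vectors `c` is `F`-admissible: the set of the minima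
of the supports belongs to `F`. -/
def Admissible (F : Set (Finset ℕ)) {k : ℕ} (c : Fin k → ℕ →₀ ℝ) : Prop :=
  Finset.univ.image (fun i => minOf (c i).support) ∈ F

/-- `p` is a norm on `X` equivalent to the given one. -/
def IsEquivalentNorm (p : Seminorm ℝ X) : Prop :=
  ∃ A B : ℝ, 0 < A ∧ 0 < B ∧ ∀ x, A * ‖x‖ ≤ p x ∧ p x ≤ B * ‖x‖

/-- `δ_F((x_i), p)`: the supremum of the `δ ≥ 0` such that
`p (∑ y_i) ≥ δ * ∑ p (y_i)` for all finite block sequences `(y_i)` of `(x_i)` that are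
`F`-admissible with respect to `(x_i)`. -/
def delta (F : Set (Finset ℕ)) (p : Seminorm ℝ X) (x : ℕ → X) : ℝ :=
  sSup {δ : ℝ | 0 ≤ δ ∧ ∀ (k : ℕ) (c : Fin k → ℕ →₀ ℝ), SuccessiveVectors c → Admissible F c →
    δ * ∑ i, p (comb x (c i)) ≤ p (∑ i, comb x (c i))}

/-- The supremum of `δ_F((x_i), p)` over all block bases `(x_i)` of `(e_i)`. -/
def deltaDot (F : Set (Finset ℕ)) (p : Seminorm ℝ X) (e : ℕ → X) : ℝ :=
  sSup {d : ℝ | ∃ x : ℕ → X, IsBlockBasis e x ∧ d = delta F p x}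

/-- The supremum of `deltaDot F p e` over all equivalent norms `p` on the space. -/
def deltaDDot (F : Set (Finset ℕ)) (e : ℕ → X) : ℝ :=
  sSup {d : ℝ | ∃ p : Seminorm ℝ X, IsEquivalentNorm p ∧ d = deltaDot F p e}

/-- `X` is asymptotic `ℓ_1` with respect to `(e_i)`: for some `C`, for all `n` and all
`e_n ≤ x_1 < ⋯ < x_n` (here with `n + 1` in place of `n`) one has
`‖∑ x_i‖ ≥ (1/C) * ∑ ‖x_i‖`. -/
def IsAsymptoticL1 (e : ℕ → X) : Prop :=
  ∃ C : ℝ, 0 < C ∧ ∀ (n : ℕ) (c : Fin (n + 1) → ℕ →₀ ℝ), SuccessiveVectors c →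
    (∀ i, ∀ m ∈ (c i).support, n ≤ m) →
    (1 / C) * ∑ i, ‖comb e (c i)‖ ≤ ‖∑ i, comb e (c i)‖

/-- The spectral index: the least countable ordinal `α` for which the constant
`deltaDDot` of `S_α` is less than one. -/
def spectralIndex (a : Ordinal.{0} → ℕ → Ordinal.{0}) (e : ℕ → X) : Ordinal.{0} :=
  sInf {α | α < ω₁ ∧ deltaDDot (schreier a α) e < 1}

end Constants

/-- `X` contains `ℓ_1`: some linear subspace of `X` is isomorphic to `ℓ_1`. -/
def ContainsL1 (X : Type*) [NormedAddCommGroup X] [NormedSpace ℝ X] : Prop :=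
  ∃ Y : Submodule ℝ X, Nonempty (lp (fun _ : ℕ => ℝ) 1 ≃L[ℝ] Y)

end AsymptoticL1

end

noncomputable section

namespace AsymptoticL1

/-! ### Regular families and labels -/

/-! Write d(α) for the constant attached to `S_α`. The theorem rests on three facts: d is
nonincreasing with d(0) = 1, d(α·n) = d(α)^n for all n, and d(α) < 1 for some countable α. The rest
is ordinal arithmetic. Let σ be the least α with d(α) < 1 and put θ = d(σ). For η < σ we get d(η·2)
= 1, so η + η < σ; hence σ is additively indecomposable, that is, a power of ω. Since (σ·n + β)·k ≤
σ·(nk + 1) for n ≥ 1 and β < σ, we have θ·θ^(nk) ≤ d(σ·n + β)^k for all k, which forces d(σ·n + β) ≥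
θ^n; monotonicity gives the other inequality, and it also gives d = 0 from σ·ω on.

Multiplicativity (`deltaDDot_schreier_mul`). Block bases may be replaced by subsequences, so
families matter only up to `Embeds`. In this sense `S_{β+α}` is the same as `S_α[S_β]`, whatever the
ladders (`embeds_schreier_add_comp`, `embeds_comp_schreier_add`), and `S_{α·n}` is the n-fold
iterate of `S_α`. Iterating a lower estimate gives d(α)^n ≤ d(α·n) (`deltaDDot_pow_le`). Conversely,
suppose P satisfies the estimate with constant t^n on the n-th iterate. Let q_j(y) be the supremum
of ∑ P(y|_I) over disjoint intervals I whose left end points form a set in the j-th iterate.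
Admissible sums of q_j are at most q_{j+1}, and t^n q_n ≤ q_0, so Q = ∑_{j<n} t^j q_j satisfies the
estimate with constant t on `S_α` itself (`exists_renorming`). The gaps between the intervals double
the number of pieces, which is harmless because `S_α[at most two]` embeds into `S_α` for α ≥ 1.
Finally Q extends from the span of the blocks to an equivalent norm on X
(`exists_equivalentNorm_extension`).

Existence of α with d(α) < 1 (`exists_deltaDDot_lt_one`). Otherwise lower estimates hold in the
original norm for every countable α with one common constant. Consider the tree of finite lists from
a countable dense set that satisfy a lower `ℓ_1`-estimate. The Schreier families embed in it trees
of arbitrarily large countable rank, while a well-founded tree on a countable set has countable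
rank. So there is an infinite branch, and it spans `ℓ_1`. -/

/-- A family is regular if it is hereditary and spreading: it contains every set that maps strictly
monotonically into one of its members by a map which does not increase the elements. -/
def Regular (F : Set (Finset ℕ)) : Prop :=
  ∀ A ∈ F, ∀ (B : Finset ℕ) (f : ℕ → ℕ), StrictMonoOn f (B : Set ℕ) →
    (∀ i ∈ B, f i ∈ A ∧ f i ≤ i) → B ∈ F

/-- `F` embeds into `G` along an infinite set of indices. -/
def Embeds (F G : Set (Finset ℕ)) : Prop :=
  ∃ N : ℕ → ℕ, StrictMono N ∧ ∀ A ∈ F, A.image N ∈ G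

/-- The sets with at most two elements. -/
def atMostTwo : Set (Finset ℕ) := {F | F.card ≤ 2}

theorem minOf_mem {E : Finset ℕ} (h : E.Nonempty) : minOf E ∈ E :=
  Finset.mem_coe.1 (Nat.sInf_mem (Finset.coe_nonempty.2 h))

theorem minOf_le {E : Finset ℕ} {i : ℕ} (h : i ∈ E) : minOf E ≤ i :=
  Nat.sInf_le (Finset.mem_coe.2 h)

/-- The greatest element of `M` which is at most `v` (zero if there is none). -/
def floorIn (M : Finset ℕ) (v : ℕ) : ℕ := (M.filter (· ≤ v)).sup id

theorem floorIn_mono (M : Finset ℕ) : Monotone (floorIn M) := fun v w h =>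
  Finset.sup_mono (fun i hi => by
    rw [Finset.mem_filter] at hi ⊢; exact ⟨hi.1, hi.2.trans h⟩)

theorem floorIn_le (M : Finset ℕ) (v : ℕ) : floorIn M v ≤ v :=
  Finset.sup_le fun _ hi => (Finset.mem_filter.1 hi).2

theorem le_floorIn {M : Finset ℕ} {m v : ℕ} (hm : m ∈ M) (h : m ≤ v) : m ≤ floorIn M v :=
  Finset.le_sup (f := id) (Finset.mem_filter.2 ⟨hm, h⟩)

theorem floorIn_mem {M : Finset ℕ} {m v : ℕ} (hm : m ∈ M) (h : m ≤ v) : floorIn M v ∈ M := by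
  have hne : (M.filter (· ≤ v)).Nonempty := ⟨m, Finset.mem_filter.2 ⟨hm, h⟩⟩
  obtain ⟨i, hi, hi'⟩ := Finset.exists_mem_eq_sup _ hne id
  rw [floorIn, hi']
  exact (Finset.mem_filter.1 hi).1

theorem floorIn_eq {M : Finset ℕ} {m v : ℕ} (hm : m ∈ M) (h : m ≤ v)
    (h' : ∀ m' ∈ M, m' ≤ v → m' ≤ m) : floorIn M v = m :=
  le_antisymm (h' _ (floorIn_mem hm h) (floorIn_le M v)) (le_floorIn hm h)

theorem floorIn_self {M : Finset ℕ} {m : ℕ} (hm : m ∈ M) : floorIn M m = m :=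
  floorIn_eq hm le_rfl fun _ _ h => h

theorem Regular.mono {F : Set (Finset ℕ)} (hF : Regular F) {A B : Finset ℕ} (hA : A ∈ F)
    (h : B ⊆ A) : B ∈ F :=
  hF A hA B id (strictMono_id.strictMonoOn _) fun _ hi => ⟨h hi, le_rfl⟩

/-- The map `N' i ↦ N i` is strictly increasing and lowers elements, so this is the spreading
property. It lets one fast-growing sequence replace a slower one. -/
theorem Regular.spread {F : Set (Finset ℕ)} (hF : Regular F) {A : Finset ℕ} {N N' : ℕ → ℕ}
    (hA : A.image N ∈ F) (hN : StrictMono N) (hN' : StrictMono N') (h : ∀ i ∈ A, N i ≤ N' i) :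
    A.image N' ∈ F := by
  have inv : ∀ i, Function.invFun N' (N' i) = i := Function.leftInverse_invFun hN'.injective
  refine hF _ hA _ (fun j => N (Function.invFun N' j)) ?_ ?_
  · intro x hx y hy hxy
    simp only [Finset.coe_image, Set.mem_image, Finset.mem_coe] at hx hy
    obtain ⟨i, hi, rfl⟩ := hx
    obtain ⟨j, hj, rfl⟩ := hy
    simp only [inv]
    exact hN (hN'.lt_iff_lt.1 hxy)
  · intro x hx
    obtain ⟨i, hi, rfl⟩ := Finset.mem_image.1 hx
    simp only [inv]
    exact ⟨Finset.mem_image_of_mem _ hi, h i hi⟩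

theorem Regular.image_mem {F : Set (Finset ℕ)} (hF : Regular F) {A : Finset ℕ} {N : ℕ → ℕ}
    (hA : A ∈ F) (hN : StrictMono N) : A.image N ∈ F :=
  hF.spread (N := id) (by simpa using hA) strictMono_id hN fun i _ => hN.le_apply

/-- A set that is split by a label function into pieces in `G`, the labels forming a set in `F`,
belongs to `F[G]`. -/
theorem mem_comp_of_label {F G : Set (Finset ℕ)} (hF : Regular F) {A : Finset ℕ} {g : ℕ → ℕ}
    (hg : MonotoneOn g (A : Set ℕ)) (hle : ∀ i ∈ A, g i ≤ i) (hAF : A.image g ∈ F)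
    (hG : ∀ m ∈ A.image g, A.filter (fun i => g i = m) ∈ G) : A ∈ comp F G := by
  set L := A.image g with hL
  let emb := L.orderEmbOfFin rfl
  have hemb : ∀ i, emb i ∈ L := fun i => Finset.orderEmbOfFin_mem L rfl i
  let E : Fin L.card → Finset ℕ := fun i => A.filter (fun v => g v = emb i)
  have hne : ∀ i, (E i).Nonempty := fun i => by
    obtain ⟨a, ha, hga⟩ := Finset.mem_image.1 (hemb i)
    exact ⟨a, Finset.mem_filter.2 ⟨ha, hga⟩⟩
  have hE : ∀ i, minOf (E i) ∈ A ∧ g (minOf (E i)) = emb i := fun i =>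
    Finset.mem_filter.1 (minOf_mem (hne i))
  refine ⟨L.card, E, ⟨hne, ?_⟩, fun i => hG _ (hemb i), ?_, ?_⟩
  · intro i j hij m hm n hn
    obtain ⟨hmA, hmg⟩ := Finset.mem_filter.1 hm
    obtain ⟨hnA, hng⟩ := Finset.mem_filter.1 hn
    by_contra hcon
    have := hg hnA hmA (not_lt.1 hcon)
    rw [hmg, hng] at this
    exact absurd (emb.strictMono hij) (not_lt.2 this)
  -- The label of a piece does not exceed its minimum, so the set of minima is a spread of the set
  -- of labels.
  · refine hF _ hAF _ g ?_ ?_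
    · intro x hx y hy hxy
      simp only [Finset.coe_image, Set.mem_image, Finset.mem_coe] at hx hy
      obtain ⟨i, -, rfl⟩ := hx
      obtain ⟨j, -, rfl⟩ := hy
      refine lt_of_le_of_ne (hg (hE i).1 (hE j).1 hxy.le) fun h => ?_
      rw [(hE i).2, (hE j).2] at h
      rw [emb.injective h] at hxy
      exact lt_irrefl _ hxy
    · intro x hx
      obtain ⟨i, -, rfl⟩ := Finset.mem_image.1 hx
      refine ⟨?_, hle _ (hE i).1⟩
      rw [(hE i).2]
      exact hemb i
  · ext v
    simp only [Finset.mem_biUnion, Finset.mem_univ, true_and]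
    refine ⟨fun hv => ?_, fun ⟨i, hi⟩ => (Finset.mem_filter.1 hi).1⟩
    have : g v ∈ Set.range emb := by
      rw [Finset.range_orderEmbOfFin]
      exact Finset.mem_coe.2 (Finset.mem_image_of_mem g hv)
    obtain ⟨i, hi⟩ := this
    exact ⟨i, Finset.mem_filter.2 ⟨hv, hi.symm⟩⟩

theorem Successive.floorIn_eq {k : ℕ} {E : Fin k → Finset ℕ} (hE : Successive E) {i : Fin k}
    {v : ℕ} (hv : v ∈ E i) :
    floorIn (Finset.univ.image fun i => minOf (E i)) v = minOf (E i) := by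
  refine AsymptoticL1.floorIn_eq
    (Finset.mem_image_of_mem (fun i => minOf (E i)) (Finset.mem_univ i)) (minOf_le hv) ?_
  intro m hm hmv
  obtain ⟨j, -, rfl⟩ := Finset.mem_image.1 hm
  rcases lt_trichotomy i j with h | rfl | h
  · exact absurd hmv (not_le.2 (hE.2 i j h v hv _ (minOf_mem (hE.1 j))))
  · exact le_rfl
  · exact (hE.2 j i h _ (minOf_mem (hE.1 j)) _ (minOf_mem (hE.1 i))).le

theorem Successive.minOf_strictMono {k : ℕ} {E : Fin k → Finset ℕ} (hE : Successive E) :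
    StrictMono fun i => minOf (E i) := fun i j h =>
  hE.2 i j h _ (minOf_mem (hE.1 i)) _ (minOf_mem (hE.1 j))

/-- Converse to `mem_comp_of_label` with a canonical label: the last minimum not exceeding the
point. From here on `F[G]` is handled through monotone labels, without enumerating pieces. -/
theorem exists_floorIn_of_mem_comp {F G : Set (Finset ℕ)} {A : Finset ℕ} (hA : A ∈ comp F G) :
    ∃ M ∈ F, M ⊆ A ∧ (∀ i ∈ A, floorIn M i ∈ M) ∧
      ∀ m ∈ M, A.filter (fun i => floorIn M i = m) ∈ G := by
  obtain ⟨k, E, hE, hEG, hM, rfl⟩ := hA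
  refine ⟨_, hM, ?_, ?_, ?_⟩
  · intro m hm
    obtain ⟨i, -, rfl⟩ := Finset.mem_image.1 hm
    exact Finset.mem_biUnion.2 ⟨i, Finset.mem_univ i, minOf_mem (hE.1 i)⟩
  · intro v hv
    obtain ⟨i, -, hi⟩ := Finset.mem_biUnion.1 hv
    rw [hE.floorIn_eq hi]
    exact Finset.mem_image_of_mem (fun i => minOf (E i)) (Finset.mem_univ i)
  · intro m hm
    obtain ⟨i, -, rfl⟩ := Finset.mem_image.1 hm
    convert hEG i using 1
    ext v
    simp only [Finset.mem_filter, Finset.mem_biUnion, Finset.mem_univ, true_and]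
    constructor
    · rintro ⟨⟨j, hj⟩, h⟩
      rw [hE.floorIn_eq hj] at h
      rwa [← hE.minOf_strictMono.injective h]
    · exact fun hv => ⟨⟨i, hv⟩, hE.floorIn_eq hv⟩

theorem image_floorIn {M A : Finset ℕ} (h : M ⊆ A) (h' : ∀ i ∈ A, floorIn M i ∈ M) :
    A.image (floorIn M) = M := by
  ext m
  simp only [Finset.mem_image]
  exact ⟨fun ⟨i, hi, him⟩ => him ▸ h' i hi, fun hm => ⟨m, h hm, floorIn_self hm⟩⟩

/-- Labels pull back along `f`: the label of `f i` is at most `f i`, hence at most `i`. -/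
theorem Regular.comp {F G : Set (Finset ℕ)} (hF : Regular F) (hG : Regular G) :
    Regular (comp F G) := by
  intro A hA B f hf hfB
  obtain ⟨M, hM, hMA, hAM, hMG⟩ := exists_floorIn_of_mem_comp hA
  have himg : B.image (fun i => floorIn M (f i)) ⊆ M := by
    intro m hm
    obtain ⟨i, hi, rfl⟩ := Finset.mem_image.1 hm
    exact hAM _ (hfB i hi).1
  refine mem_comp_of_label hF (g := fun i => floorIn M (f i))
    (fun x hx y hy hxy => floorIn_mono M (hf.monotoneOn hx hy hxy))
    (fun i hi => (floorIn_le M _).trans (hfB i hi).2) (hF.mono hM himg) ?_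
  intro m hm
  refine hG _ (hMG m (himg hm)) _ f (hf.mono fun i hi => ?_) ?_
  · exact Finset.mem_coe.2 (Finset.mem_filter.1 hi).1
  · intro i hi
    obtain ⟨hi, him⟩ := Finset.mem_filter.1 hi
    exact ⟨Finset.mem_filter.2 ⟨(hfB i hi).1, him⟩, (hfB i hi).2⟩

/-- Each coarse piece carries its own set of fine minima; the fine label of `i` is the floor of `i`
in the set belonging to its coarse piece. This fine label stays in the same coarse piece, so coarse
labels can be read off fine ones. -/
theorem comp_assoc_subset {F G H : Set (Finset ℕ)} (hF : Regular F) (hG : Regular G) :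
    comp F (comp G H) ⊆ comp (comp F G) H := by
  intro A hA
  obtain ⟨M, hM, hMA, hAM, hMG⟩ := exists_floorIn_of_mem_comp hA
  choose! K hKG hKA hAK hKH using fun m hm => exists_floorIn_of_mem_comp (hMG m hm)
  set g : ℕ → ℕ := fun i => floorIn (K (floorIn M i)) i with hg
  have hfib : ∀ i ∈ A, i ∈ A.filter (fun j => floorIn M j = floorIn M i) := fun i hi =>
    Finset.mem_filter.2 ⟨hi, rfl⟩
  have hgK : ∀ i ∈ A, g i ∈ K (floorIn M i) := fun i hi => hAK _ (hAM i hi) i (hfib i hi)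
  have hgA : ∀ i ∈ A, g i ∈ A ∧ floorIn M (g i) = floorIn M i := fun i hi =>
    Finset.mem_filter.1 (hKA _ (hAM i hi) (hgK i hi))
  have hgle : ∀ i, g i ≤ i := fun i => floorIn_le _ _
  refine mem_comp_of_label (hF.comp hG) (g := g) ?_ (fun i _ => hgle i) ?_ ?_
  · intro x hx y hy hxy
    rcases (floorIn_mono M hxy).eq_or_lt with h | h
    · simp only [hg, h]
      exact floorIn_mono _ hxy
    · by_contra hcon
      have := floorIn_mono M (not_le.1 hcon).le
      rw [(hgA x hx).2, (hgA y hy).2] at this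
      exact absurd h (not_lt.2 this)
  · refine mem_comp_of_label hF (g := floorIn M) ((floorIn_mono M).monotoneOn _)
      (fun i _ => floorIn_le M i) (hF.mono hM ?_) ?_
    · intro m hm
      obtain ⟨j, hj, rfl⟩ := Finset.mem_image.1 hm
      obtain ⟨i, hi, rfl⟩ := Finset.mem_image.1 hj
      exact hAM _ (hgA i hi).1
    · intro m hm
      obtain ⟨j, hj, rfl⟩ := Finset.mem_image.1 hm
      obtain ⟨i, hi, rfl⟩ := Finset.mem_image.1 hj
      refine hG.mono (hKG _ (hAM _ (hgA i hi).1)) ?_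
      intro v hv
      obtain ⟨hv, hv'⟩ := Finset.mem_filter.1 hv
      obtain ⟨l, hl, rfl⟩ := Finset.mem_image.1 hv
      rw [← hv', (hgA l hl).2]
      exact hgK l hl
  · intro m hm
    obtain ⟨i, hi, rfl⟩ := Finset.mem_image.1 hm
    convert hKH _ (hAM i hi) _ (hgK i hi) using 1
    ext v
    simp only [Finset.mem_filter]
    constructor
    · rintro ⟨hv, hvi⟩
      have : floorIn M v = floorIn M i := by
        rw [← (hgA v hv).2, ← (hgA i hi).2, hvi]
      refine ⟨⟨hv, this⟩, ?_⟩
      rw [← hvi, hg]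
      simp only [this]
    · rintro ⟨⟨hv, hvi⟩, h⟩
      refine ⟨hv, ?_⟩
      rw [← h, hg]
      simp only [hvi]

/-- The coarse label is the composite of the two floor maps; inside a coarse piece the inner floor
is the fine label. -/
theorem comp_assoc_superset {F G H : Set (Finset ℕ)} (hF : Regular F) (hG : Regular G) :
    comp (comp F G) H ⊆ comp F (comp G H) := by
  intro A hA
  obtain ⟨M, hM, hMA, hAM, hMH⟩ := exists_floorIn_of_mem_comp hA
  obtain ⟨L, hL, hLM, hML, hLG⟩ := exists_floorIn_of_mem_comp hM
  refine mem_comp_of_label hF (g := fun i => floorIn L (floorIn M i))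
    (((floorIn_mono L).comp (floorIn_mono M)).monotoneOn _)
    (fun i _ => (floorIn_le _ _).trans (floorIn_le _ _)) (hF.mono hL ?_) ?_
  · intro m hm
    obtain ⟨i, hi, rfl⟩ := Finset.mem_image.1 hm
    exact hML _ (hAM i hi)
  · intro m hm
    obtain ⟨i, hi, rfl⟩ := Finset.mem_image.1 hm
    have hsub : ∀ v ∈ A.filter (fun j => floorIn L (floorIn M j) = floorIn L (floorIn M i)),
        v ∈ A ∧ floorIn L (floorIn M v) = floorIn L (floorIn M i) := fun v hv =>
      Finset.mem_filter.1 hv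
    refine mem_comp_of_label hG (g := floorIn M) ((floorIn_mono M).monotoneOn _)
      (fun i _ => floorIn_le M i) (hG.mono (hLG _ (hML _ (hAM i hi))) ?_) ?_
    · intro v hv
      obtain ⟨j, hj, rfl⟩ := Finset.mem_image.1 hv
      exact Finset.mem_filter.2 ⟨hAM j (hsub j hj).1, (hsub j hj).2⟩
    · intro v hv
      obtain ⟨j, hj, rfl⟩ := Finset.mem_image.1 hv
      convert hMH _ (hAM j (hsub j hj).1) using 1
      ext w
      simp only [Finset.mem_filter]
      constructor
      · exact fun h => ⟨h.1.1, h.2⟩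
      · rintro ⟨hw, hwj⟩
        refine ⟨⟨hw, ?_⟩, hwj⟩
        rw [hwj]
        exact (hsub j hj).2

/-! ### Embeddings of families along subsequences -/

theorem Embeds.refl (F : Set (Finset ℕ)) : Embeds F F :=
  ⟨id, strictMono_id, fun A hA => by simpa using hA⟩

theorem Embeds.of_subset {F G : Set (Finset ℕ)} (h : F ⊆ G) : Embeds F G :=
  ⟨id, strictMono_id, fun A hA => by simpa using h hA⟩

theorem Embeds.trans {F G H : Set (Finset ℕ)} (h : Embeds F G) (h' : Embeds G H) :
    Embeds F H := by
  obtain ⟨N, hN, h⟩ := h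
  obtain ⟨N', hN', h'⟩ := h'
  refine ⟨N' ∘ N, hN'.comp hN, fun A hA => ?_⟩
  rw [← Finset.image_image]
  exact h' _ (h _ hA)

theorem image_mem_comp {F G F' G' : Set (Finset ℕ)} {N : ℕ → ℕ} (hN : StrictMono N)
    (hF' : Regular F') (hF : ∀ A ∈ F, A.image N ∈ F') (hG : ∀ A ∈ G, A.image N ∈ G')
    {A : Finset ℕ} (hA : A ∈ comp F G) : A.image N ∈ comp F' G' := by
  obtain ⟨M, hM, hMA, hAM, hMG⟩ := exists_floorIn_of_mem_comp hA
  have inv : ∀ i, Function.invFun N (N i) = i := Function.leftInverse_invFun hN.injective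
  refine mem_comp_of_label hF' (g := fun i => N (floorIn M (Function.invFun N i))) ?_ ?_
    (hF'.mono (hF _ hM) ?_) ?_
  · intro x hx y hy hxy
    simp only [Finset.coe_image, Set.mem_image, Finset.mem_coe] at hx hy
    obtain ⟨i, hi, rfl⟩ := hx
    obtain ⟨j, hj, rfl⟩ := hy
    simp only [inv]
    exact hN.monotone (floorIn_mono M (hN.le_iff_le.1 hxy))
  · intro x hx
    obtain ⟨i, hi, rfl⟩ := Finset.mem_image.1 hx
    simp only [inv]
    exact hN.monotone (floorIn_le M i)
  · intro m hm
    simp only [Finset.image_image, Finset.mem_image, Function.comp_apply, inv] at hm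
    obtain ⟨i, hi, rfl⟩ := hm
    exact Finset.mem_image_of_mem N (hAM i hi)
  · intro m hm
    simp only [Finset.image_image, Finset.mem_image, Function.comp_apply, inv] at hm
    obtain ⟨i, hi, rfl⟩ := hm
    convert hG _ (hMG _ (hAM i hi)) using 1
    ext v
    simp only [Finset.mem_filter, Finset.mem_image]
    constructor
    · rintro ⟨⟨w, hw, rfl⟩, h⟩
      rw [inv] at h
      exact ⟨w, ⟨hw, hN.injective h⟩, rfl⟩
    · rintro ⟨w, ⟨hw, h⟩, rfl⟩
      refine ⟨⟨w, hw, rfl⟩, ?_⟩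
      rw [inv, h]

theorem Embeds.comp_left {F F' G : Set (Finset ℕ)} (h : Embeds F F') (hF' : Regular F')
    (hG : Regular G) : Embeds (comp F G) (comp F' G) := by
  obtain ⟨N, hN, h⟩ := h
  exact ⟨N, hN, fun A hA => image_mem_comp hN hF' h (fun B hB => hG.image_mem hB hN) hA⟩

theorem Embeds.comp_right {F G G' : Set (Finset ℕ)} (h : Embeds G G') (hF : Regular F) :
    Embeds (comp F G) (comp F G') := by
  obtain ⟨N, hN, h⟩ := h
  exact ⟨N, hN, fun A hA => image_mem_comp hN hF (fun B hB => hF.image_mem hB hN) h hA⟩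

/-- Countably many embeddings can be realised, on tails, by a single one. -/
theorem exists_diagonal {F G : ℕ → Set (Finset ℕ)} (h : ∀ n, Embeds (F n) (G n))
    (hG : ∀ n, Regular (G n)) (m : ℕ → ℕ) :
    ∃ N : ℕ → ℕ, StrictMono N ∧ ∀ n, ∀ A ∈ F n, (∀ i ∈ A, n ≤ i) →
      A.image N ∈ G n ∧ ∀ j ∈ A.image N, m n ≤ j := by
  choose K hK hKA using h
  -- `N i` dominates `K n i` and `m n` for all `n ≤ i` simultaneously; on sets contained in `[n, ∞)`
  -- spreading then replaces `K n` by `N`.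
  set N : ℕ → ℕ := fun i => i + ∑ n ∈ Finset.range (i + 1), (K n i + m n) with hN
  have hle : ∀ n i, n ≤ i → K n i + m n ≤ N i := fun n i hni => by
    have := Finset.single_le_sum (f := fun n => K n i + m n) (fun _ _ => Nat.zero_le _)
      (Finset.mem_range.2 (Nat.lt_add_one_of_le hni))
    simp only [hN]
    exact this.trans (Nat.le_add_left _ _)
  have hmono : StrictMono N := by
    refine strictMono_nat_of_lt_succ fun i => ?_
    have h1 : ∑ n ∈ Finset.range (i + 1), (K n i + m n) ≤
        ∑ n ∈ Finset.range (i + 1), (K n (i + 1) + m n) :=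
      Finset.sum_le_sum fun n _ => Nat.add_le_add_right ((hK n).monotone (Nat.le_succ i)) _
    have h2 := Finset.sum_range_succ (fun n => K n (i + 1) + m n) (i + 1)
    simp only [hN]
    omega
  refine ⟨N, hmono, fun n A hA hnA => ⟨?_, ?_⟩⟩
  · exact (hG n).spread (hKA n A hA) (hK n) hmono fun i hi =>
      (Nat.le_add_right _ _).trans (hle n i (hnA i hi))
  · intro j hj
    obtain ⟨i, hi, rfl⟩ := Finset.mem_image.1 hj
    exact (Nat.le_add_left _ _).trans (hle n i (hnA i hi))

/-! ### The Schreier families -/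

theorem schreier_zero (a : Ordinal.{0} → ℕ → Ordinal.{0}) : schreier a 0 = schreierZero := by
  simp [schreier]

theorem schreier_add_one (a : Ordinal.{0} → ℕ → Ordinal.{0}) (α : Ordinal.{0}) :
    schreier a (α + 1) = comp schreierOne (schreier a α) := by
  simp [schreier]

theorem mem_schreier_limit (a : Ordinal.{0} → ℕ → Ordinal.{0}) {α : Ordinal.{0}}
    (hα : Order.IsSuccLimit α) {A : Finset ℕ} :
    A ∈ schreier a α ↔ ∃ n, a α n < α ∧ A ∈ schreier a (a α n) ∧ ∀ i ∈ A, n ≤ i := by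
  rw [schreier, Ordinal.limitRecOn_limit _ _ _ _ hα]
  simp only [Set.mem_ofPred_eq, exists_prop, schreier]

theorem regular_schreierZero : Regular schreierZero := by
  intro A hA B f hf hfB
  exact (Finset.card_le_card_of_injOn f (fun i hi => (hfB i hi).1) hf.injOn).trans hA

theorem regular_atMostTwo : Regular atMostTwo := by
  intro A hA B f hf hfB
  exact (Finset.card_le_card_of_injOn f (fun i hi => (hfB i hi).1) hf.injOn).trans hA

theorem regular_schreierOne : Regular schreierOne := by
  intro A hA B f hf hfB i hi
  have h1 := Finset.card_le_card_of_injOn f (fun i hi => (hfB i hi).1) hf.injOn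
  have h2 := hA _ (hfB i hi).1
  have h3 := (hfB i hi).2
  omega

theorem regular_schreier (a : Ordinal.{0} → ℕ → Ordinal.{0}) (α : Ordinal.{0}) :
    Regular (schreier a α) := by
  induction α using Ordinal.limitRecOn with
  | zero => rw [schreier_zero]; exact regular_schreierZero
  | add_one α ih => rw [schreier_add_one]; exact regular_schreierOne.comp ih
  | limit α hα ih =>
    intro A hA B f hf hfB
    rw [mem_schreier_limit a hα] at hA ⊢
    obtain ⟨n, hn, hA, hnA⟩ := hA
    exact ⟨n, hn, ih _ hn A hA B f hf hfB, fun i hi => (hnA _ (hfB i hi).1).trans (hfB i hi).2⟩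

theorem singleton_mem_schreierOne (i : ℕ) : {i} ∈ schreierOne := by
  simp [schreierOne]

/-- A member of `G` belongs to `F[G]` when `F` contains the singletons. -/
theorem subset_comp {F G : Set (Finset ℕ)} (hF : Regular F) (hs : ∀ i, {i} ∈ F) :
    G ⊆ comp F G := by
  intro A hA
  rcases A.eq_empty_or_nonempty with rfl | hne
  · exact mem_comp_of_label hF (g := id) (fun _ _ _ _ h => h) (by simp)
      (by simpa using hF.mono (hs 0) (by simp)) (by simp)
  · have himg : A.image (fun _ => minOf A) = {minOf A} := Finset.image_const hne _
    refine mem_comp_of_label hF (g := fun _ => minOf A) (fun _ _ _ _ _ => le_rfl)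
      (fun i hi => minOf_le hi) (himg ▸ hs _) ?_
    intro m hm
    rw [himg, Finset.mem_singleton] at hm
    rw [Finset.filter_true_of_mem fun _ _ => hm.symm]
    exact hA

theorem comp_schreierZero_left {G : Set (Finset ℕ)} (hG : ∅ ∈ G) : comp schreierZero G ⊆ G := by
  intro A hA
  obtain ⟨M, hM, hMA, hAM, hMG⟩ := exists_floorIn_of_mem_comp hA
  rcases A.eq_empty_or_nonempty with rfl | ⟨i, hi⟩
  · exact hG
  · have := hMG _ (hAM i hi)
    rwa [Finset.filter_true_of_mem fun j hj =>
      Finset.card_le_one.1 hM _ (hAM j hj) _ (hAM i hi)] at this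

theorem subset_comp_schreierZero {F : Set (Finset ℕ)} (hF : Regular F) :
    F ⊆ comp F schreierZero := by
  intro A hA
  refine mem_comp_of_label hF (g := id) (fun _ _ _ _ h => h) (fun _ _ => le_rfl)
    (by simpa using hA) ?_
  intro m _
  refine Finset.card_le_one.2 fun x hx y hy => ?_
  rw [Finset.mem_filter] at hx hy
  exact hx.2.trans hy.2.symm

theorem comp_schreierZero_subset {F : Set (Finset ℕ)} (hF : Regular F) :
    comp F schreierZero ⊆ F := by
  intro A hA
  obtain ⟨M, hM, hMA, hAM, hMG⟩ := exists_floorIn_of_mem_comp hA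
  refine hF M hM A (floorIn M) ?_ fun i hi => ⟨hAM i hi, floorIn_le M i⟩
  intro x hx y hy hxy
  refine lt_of_le_of_ne (floorIn_mono M hxy.le) fun h => hxy.ne ?_
  exact Finset.card_le_one.1 (hMG _ (hAM x hx)) x (Finset.mem_filter.2 ⟨hx, rfl⟩) y
    (Finset.mem_filter.2 ⟨hy, h.symm⟩)

theorem singleton_mem_schreier {a : Ordinal.{0} → ℕ → Ordinal.{0}} (ha : IsLadderSystem a)
    {α : Ordinal.{0}} (hα : α < ω₁) (i : ℕ) : {i} ∈ schreier a α := by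
  induction α using Ordinal.limitRecOn with
  | zero => rw [schreier_zero]; simp [schreierZero]
  | add_one α ih =>
    rw [schreier_add_one]
    exact subset_comp regular_schreierOne singleton_mem_schreierOne
      (ih ((lt_add_one α).trans hα))
  | limit α hl ih =>
    rw [mem_schreier_limit a hl]
    have h0 := (ha α hα hl).2.1 0
    exact ⟨0, h0, ih _ h0 (h0.trans hα), fun _ _ => Nat.zero_le _⟩

theorem empty_mem_schreier {a : Ordinal.{0} → ℕ → Ordinal.{0}} (ha : IsLadderSystem a)
    {α : Ordinal.{0}} (hα : α < ω₁) : ∅ ∈ schreier a α :=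
  (regular_schreier a α).mono (singleton_mem_schreier ha hα 0) (by simp)

theorem IsLadderSystem.exists_le {a : Ordinal.{0} → ℕ → Ordinal.{0}} (ha : IsLadderSystem a)
    {α β : Ordinal.{0}} (hα : α < ω₁) (hl : Order.IsSuccLimit α) (h : β < α) :
    ∃ n, β ≤ a α n := by
  obtain ⟨-, ⟨n, rfl⟩, hn, -⟩ := ((ha α hα hl).2.2).exists_between h
  exact ⟨n, hn.le⟩

/-- A shift by `n` enforces the condition that all elements are at least `n`. -/
theorem embeds_schreier_limit {a : Ordinal.{0} → ℕ → Ordinal.{0}} {α : Ordinal.{0}} {n : ℕ}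
    (hl : Order.IsSuccLimit α) (hn : a α n < α) :
    Embeds (schreier a (a α n)) (schreier a α) := by
  refine ⟨fun i => i + n, fun i j h => Nat.add_lt_add_right h n, fun A hA => ?_⟩
  rw [mem_schreier_limit a hl]
  refine ⟨n, hn, (regular_schreier a _).image_mem hA fun i j h => Nat.add_lt_add_right h n, ?_⟩
  intro j hj
  obtain ⟨i, -, rfl⟩ := Finset.mem_image.1 hj
  exact Nat.le_add_left n i

/-- Inclusion fails in general, since small elements restrict which terms of a ladder may be used;
passing to a subsequence removes this obstruction. -/
theorem embeds_schreier_of_le {a : Ordinal.{0} → ℕ → Ordinal.{0}} (ha : IsLadderSystem a)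
    {α β : Ordinal.{0}} (hβ : β < ω₁) (h : α ≤ β) : Embeds (schreier a α) (schreier a β) := by
  induction β using Ordinal.limitRecOn with
  | zero => rw [nonpos_iff_eq_zero.1 h]; exact Embeds.refl _
  | add_one β ih =>
    rcases h.eq_or_lt with rfl | h
    · exact Embeds.refl _
    · refine (ih ((lt_add_one β).trans hβ) (Order.lt_add_one_iff.1 h)).trans (Embeds.of_subset ?_)
      rw [schreier_add_one]
      exact subset_comp regular_schreierOne singleton_mem_schreierOne
  | limit β hl ih =>
    rcases h.eq_or_lt with rfl | h
    · exact Embeds.refl _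
    · obtain ⟨n, hn⟩ := ha.exists_le hβ hl h
      have hlt := (ha β hβ hl).2.1 n
      exact (ih _ hlt (hlt.trans hβ) hn).trans (embeds_schreier_limit hl hlt)

/-- Induction on `α`: successors are associativity of `comp`; at limits the ladder of `β + α` and
the translated ladder of `α` are unrelated but cofinal in each other, and the embeddings at the
separate levels are diagonalised. -/
theorem embeds_schreier_add_comp {a : Ordinal.{0} → ℕ → Ordinal.{0}} (ha : IsLadderSystem a)
    {α β : Ordinal.{0}} (h : β + α < ω₁) :
    Embeds (schreier a (β + α)) (comp (schreier a α) (schreier a β)) := by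
  induction α using Ordinal.limitRecOn with
  | zero =>
    rw [add_zero, schreier_zero]
    exact Embeds.of_subset (subset_comp regular_schreierZero (by simp [schreierZero]))
  | add_one α ih =>
    rw [← add_assoc] at h ⊢
    rw [schreier_add_one, schreier_add_one]
    exact ((ih ((lt_add_one _).trans h)).comp_right regular_schreierOne).trans
      (Embeds.of_subset (comp_assoc_subset regular_schreierOne (regular_schreier a α)))
  | limit α hl ih =>
    have hα : α < ω₁ := lt_of_le_of_lt le_add_self h
    have hl' : Order.IsSuccLimit (β + α) := Ordinal.isSuccLimit_add β hl
    have hlt := (ha _ h hl').2.1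
    have hlt' := (ha _ hα hl).2.1
    have key : ∀ n, ∃ m, a (β + α) n ≤ β + a α m := fun n => by
      obtain ⟨γ, hγ, hle⟩ := (Ordinal.lt_add_iff_of_isSuccLimit hl).1 (hlt n)
      obtain ⟨m, hm⟩ := ha.exists_le hα hl hγ
      exact ⟨m, hle.le.trans (by gcongr)⟩
    choose m hm using key
    have hb : ∀ n, β + a α (m n) < ω₁ := fun n =>
      lt_trans (by gcongr; exact hlt' (m n)) h
    -- The bound `m` pushes the image beyond `m n`, as membership of its minima in the limit family
    -- through level `m n` requires.
    obtain ⟨N, hN, hNA⟩ := exists_diagonal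
      (fun n => (embeds_schreier_of_le ha (hb n) (hm n)).trans (ih _ (hlt' (m n)) (hb n)))
      (fun n => (regular_schreier a _).comp (regular_schreier a _)) m
    refine ⟨N, hN, fun A hA => ?_⟩
    obtain ⟨n, -, hA, hnA⟩ := (mem_schreier_limit a hl').1 hA
    obtain ⟨h1, h2⟩ := hNA n A hA hnA
    obtain ⟨M, hM, hMA, hAM, hMG⟩ := exists_floorIn_of_mem_comp h1
    refine mem_comp_of_label (regular_schreier a α) (g := floorIn M)
      ((floorIn_mono M).monotoneOn _) (fun i _ => floorIn_le M i) ?_ ?_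
    · rw [image_floorIn hMA hAM, mem_schreier_limit a hl]
      exact ⟨m n, hlt' (m n), hM, fun i hi => h2 i (hMA hi)⟩
    · rwa [image_floorIn hMA hAM]

theorem embeds_comp_schreier_add {a : Ordinal.{0} → ℕ → Ordinal.{0}} (ha : IsLadderSystem a)
    {α β : Ordinal.{0}} (h : β + α < ω₁) :
    Embeds (comp (schreier a α) (schreier a β)) (schreier a (β + α)) := by
  induction α using Ordinal.limitRecOn with
  | zero =>
    rw [add_zero] at h ⊢
    rw [schreier_zero]
    exact Embeds.of_subset (comp_schreierZero_left (empty_mem_schreier ha h))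
  | add_one α ih =>
    rw [← add_assoc] at h ⊢
    rw [schreier_add_one, schreier_add_one]
    exact (Embeds.of_subset (comp_assoc_superset regular_schreierOne (regular_schreier a α))).trans
      ((ih ((lt_add_one _).trans h)).comp_right regular_schreierOne)
  | limit α hl ih =>
    have hα : α < ω₁ := lt_of_le_of_lt le_add_self h
    have hl' : Order.IsSuccLimit (β + α) := Ordinal.isSuccLimit_add β hl
    have hlt := (ha _ h hl').2.1
    have hlt' := (ha _ hα hl).2.1
    have hb : ∀ n, β + a α n < β + α := fun n => by gcongr; exact hlt' n
    choose m hm using fun n => ha.exists_le h hl' (hb n)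
    obtain ⟨N, hN, hNA⟩ := exists_diagonal
      (fun n => (ih _ (hlt' n) ((hb n).trans h)).trans
        (embeds_schreier_of_le ha ((hlt (m n)).trans h) (hm n)))
      (fun n => regular_schreier a _) m
    refine ⟨N, hN, fun A hA => ?_⟩
    obtain ⟨M, hM, hMA, hAM, hMG⟩ := exists_floorIn_of_mem_comp hA
    obtain ⟨n, -, hM, hnM⟩ := (mem_schreier_limit a hl).1 hM
    -- Each element is at least its label, and the labels lie in `[n, ∞)`; so all of `A` lies there.
    obtain ⟨h1, h2⟩ := hNA n A
      (mem_comp_of_label (regular_schreier a _) (g := floorIn M) ((floorIn_mono M).monotoneOn _)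
        (fun i _ => floorIn_le M i) (by rwa [image_floorIn hMA hAM])
        (by rwa [image_floorIn hMA hAM]))
      (fun i hi => (hnM _ (hAM i hi)).trans (floorIn_le M i))
    rw [mem_schreier_limit a hl']
    exact ⟨m n, hlt (m n), h1, h2⟩

/-- Pairs double the allowed cardinality `i + 1`, and `2 * (i + 1) = (2 * i + 1) + 1` is exactly
what is allowed at `2 * i + 1`. -/
theorem embeds_schreierOne_comp_atMostTwo : Embeds (comp schreierOne atMostTwo) schreierOne := by
  refine ⟨fun i => 2 * i + 1, fun i j h => by simp only; omega, fun A hA => ?_⟩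
  obtain ⟨M, hM, hMA, hAM, hMG⟩ := exists_floorIn_of_mem_comp hA
  intro j hj
  obtain ⟨i, hi, rfl⟩ := Finset.mem_image.1 hj
  have h1 : A.card ≤ 2 * M.card := Finset.card_le_mul_card_image_of_maps_to hAM 2 hMG
  have h2 := hM _ (hAM i hi)
  have h3 := floorIn_le M i
  have h4 := Finset.card_image_le (s := A) (f := fun i => 2 * i + 1)
  omega

theorem schreier_one_eq (a : Ordinal.{0} → ℕ → Ordinal.{0}) : schreier a 1 = schreierOne := by
  rw [← zero_add (1 : Ordinal), schreier_add_one, schreier_zero]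
  exact (comp_schreierZero_subset regular_schreierOne).antisymm
    (subset_comp_schreierZero regular_schreierOne)

/-- Writing `α = 1 + γ` puts `S_1` innermost in `S_γ[S_1]`, and this `S_1` absorbs the pairs. -/
theorem embeds_schreier_comp_atMostTwo {a : Ordinal.{0} → ℕ → Ordinal.{0}}
    (ha : IsLadderSystem a) {α : Ordinal.{0}} (hα : α < ω₁) (h1 : 1 ≤ α) :
    Embeds (comp (schreier a α) atMostTwo) (schreier a α) := by
  obtain ⟨γ, rfl⟩ : ∃ γ, α = 1 + γ := ⟨α - 1, (Ordinal.add_sub_cancel_of_le h1).symm⟩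
  have hγ := regular_schreier a γ
  have hS := regular_schreier a 1
  refine ((embeds_schreier_add_comp ha hα).comp_left (hγ.comp hS) regular_atMostTwo).trans ?_
  refine (Embeds.of_subset (comp_assoc_superset hγ hS)).trans ?_
  refine Embeds.trans ?_ (embeds_comp_schreier_add ha hα)
  rw [schreier_one_eq]
  exact embeds_schreierOne_comp_atMostTwo.comp_right hγ

/-! ### Iterates of a family and multiples of an ordinal -/

/-- The iterates `F[F[⋯[S_0]]]`. -/
def iter (F : Set (Finset ℕ)) : ℕ → Set (Finset ℕ)
  | 0 => schreierZero
  | n + 1 => comp F (iter F n)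

theorem regular_iter {F : Set (Finset ℕ)} (hF : Regular F) (n : ℕ) : Regular (iter F n) := by
  induction n with
  | zero => exact regular_schreierZero
  | succ n ih => exact hF.comp ih

theorem mul_natCast_lt_omega_one {α : Ordinal.{0}} (hα : α < ω₁) (n : ℕ) : α * n < ω₁ :=
  Ordinal.isPrincipal_mul_omega 1 hα
    ((Ordinal.natCast_lt_omega0 n).trans Ordinal.omega0_lt_omega_one)

theorem embeds_schreier_mul_iter {a : Ordinal.{0} → ℕ → Ordinal.{0}} (ha : IsLadderSystem a)
    {α : Ordinal.{0}} (hα : α < ω₁) (n : ℕ) :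
    Embeds (schreier a (α * n)) (iter (schreier a α) n) := by
  induction n with
  | zero => simpa [schreier_zero, iter] using Embeds.refl _
  | succ n ih =>
    have h := mul_natCast_lt_omega_one hα (n + 1)
    rw [Nat.cast_succ, mul_add, mul_one] at h ⊢
    exact (embeds_schreier_add_comp ha h).trans (ih.comp_right (regular_schreier a α))

theorem embeds_iter_schreier_mul {a : Ordinal.{0} → ℕ → Ordinal.{0}} (ha : IsLadderSystem a)
    {α : Ordinal.{0}} (hα : α < ω₁) (n : ℕ) :
    Embeds (iter (schreier a α) n) (schreier a (α * n)) := by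
  induction n with
  | zero => simpa [schreier_zero, iter] using Embeds.refl _
  | succ n ih =>
    have h := mul_natCast_lt_omega_one hα (n + 1)
    rw [Nat.cast_succ, mul_add, mul_one] at h ⊢
    exact (ih.comp_right (regular_schreier a α)).trans (embeds_comp_schreier_add ha h)

theorem embeds_iter_comp_atMostTwo {a : Ordinal.{0} → ℕ → Ordinal.{0}}
    (ha : IsLadderSystem a) {α : Ordinal.{0}} (hα : α < ω₁) (h1 : 1 ≤ α) {n : ℕ} (hn : n ≠ 0) :
    Embeds (comp (iter (schreier a α) n) atMostTwo) (schreier a (α * n)) := by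
  refine ((embeds_iter_schreier_mul ha hα n).comp_left (regular_schreier a _)
    regular_atMostTwo).trans
    (embeds_schreier_comp_atMostTwo ha (mul_natCast_lt_omega_one hα n) ?_)
  exact h1.trans (Ordinal.le_mul_left α (by exact_mod_cast Nat.pos_of_ne_zero hn))

/-! ### Lower estimates for seminorms on the finitely supported vectors -/

/-- The lower `ℓ_1`-estimate with constant `δ` on `F`-admissible block sequences. -/
def LowerEstimate (F : Set (Finset ℕ)) (P : Seminorm ℝ (ℕ →₀ ℝ)) (δ : ℝ) : Prop :=
  ∀ (k : ℕ) (c : Fin k → ℕ →₀ ℝ), SuccessiveVectors c → Admissible F c →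
    δ * ∑ i, P (c i) ≤ P (∑ i, c i)

/-- The lower `ℓ_1`-estimate with constant `δ`, for decompositions given by label functions. -/
def LabelEstimate (F : Set (Finset ℕ)) (P : Seminorm ℝ (ℕ →₀ ℝ)) (δ : ℝ) : Prop :=
  ∀ (y : ℕ →₀ ℝ) (g : ℕ → ℕ), MonotoneOn g (y.support : Set ℕ) → (∀ i ∈ y.support, g i ≤ i) →
    y.support.image g ∈ F →
      δ * ∑ m ∈ y.support.image g, P (y.filter fun i => g i = m) ≤ P y

theorem sum_filter_label (y : ℕ →₀ ℝ) (g : ℕ → ℕ) (L : Finset ℕ) (h : ∀ i ∈ y.support, g i ∈ L) :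
    ∑ m ∈ L, (y.filter fun i => g i = m) = y := by
  ext v
  rw [Finsupp.finsetSum_apply]
  simp only [Finsupp.filter_apply]
  rw [Finset.sum_ite_eq]
  split_ifs with hv
  · rfl
  · by_contra h0
    exact hv (h v (Finsupp.mem_support_iff.2 (Ne.symm h0)))

theorem mem_support_filter {y : ℕ →₀ ℝ} {p : ℕ → Prop} [DecidablePred p] {v : ℕ} :
    v ∈ (y.filter p).support ↔ v ∈ y.support ∧ p v := by
  rw [Finsupp.support_filter, Finset.mem_filter]

/-- Labels lie below the minima of their pieces, so regularity makes the pieces an admissible block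
sequence. -/
theorem LowerEstimate.labelEstimate {F : Set (Finset ℕ)} (hF : Regular F)
    {P : Seminorm ℝ (ℕ →₀ ℝ)} {δ : ℝ} (h : LowerEstimate F P δ) : LabelEstimate F P δ := by
  intro y g hg hle hyF
  set L := y.support.image g with hL
  let emb := L.orderEmbOfFin rfl
  have hemb : ∀ i, emb i ∈ L := fun i => Finset.orderEmbOfFin_mem L rfl i
  let c : Fin L.card → ℕ →₀ ℝ := fun i => y.filter (fun v => g v = emb i)
  have hne : ∀ i, (c i).support.Nonempty := fun i => by
    obtain ⟨a, ha, hga⟩ := Finset.mem_image.1 (hemb i)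
    exact ⟨a, mem_support_filter.2 ⟨ha, hga⟩⟩
  have hc : ∀ i, minOf (c i).support ∈ y.support ∧ g (minOf (c i).support) = emb i := fun i =>
    mem_support_filter.1 (minOf_mem (hne i))
  have hsum : ∀ {M : Type} [AddCommMonoid M] (f : ℕ → M), ∑ i, f (emb i) = ∑ m ∈ L, f m := by
    intro M _ f
    have : L = Finset.univ.map emb.toEmbedding := by
      ext m
      simp only [Finset.mem_map, Finset.mem_univ, true_and]
      exact (Set.ext_iff.1 (Finset.range_orderEmbOfFin L rfl) m).symm
    conv_rhs => rw [this]
    rw [Finset.sum_map]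
    rfl
  have key := h L.card c ⟨hne, ?_⟩ ?_
  · rw [hsum (fun m => P (y.filter fun v => g v = m)),
      hsum (fun m => y.filter fun v => g v = m),
      sum_filter_label y g L fun i hi => Finset.mem_image_of_mem g hi] at key
    exact key
  · intro i j hij m hm n hn
    obtain ⟨hmA, hmg⟩ := mem_support_filter.1 hm
    obtain ⟨hnA, hng⟩ := mem_support_filter.1 hn
    by_contra hcon
    have := hg hnA hmA (not_lt.1 hcon)
    rw [hmg, hng] at this
    exact absurd (emb.strictMono hij) (not_lt.2 this)
  · refine hF _ hyF _ g ?_ ?_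
    · intro x hx y hy hxy
      simp only [Finset.coe_image, Set.mem_image, Finset.mem_coe] at hx hy
      obtain ⟨i, -, rfl⟩ := hx
      obtain ⟨j, -, rfl⟩ := hy
      refine lt_of_le_of_ne (hg (hc i).1 (hc j).1 hxy.le) fun h => ?_
      rw [(hc i).2, (hc j).2] at h
      rw [emb.injective h] at hxy
      exact lt_irrefl _ hxy
    · intro x hx
      obtain ⟨i, -, rfl⟩ := Finset.mem_image.1 hx
      refine ⟨?_, hle _ (hc i).1⟩
      rw [(hc i).2]
      exact hemb i

theorem SuccessiveVectors.sum_apply {k : ℕ} {c : Fin k → ℕ →₀ ℝ} (hc : SuccessiveVectors c)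
    {i : Fin k} {v : ℕ} (hv : v ∈ (c i).support) : (∑ j, c j) v = c i v := by
  rw [Finsupp.finsetSum_apply, Finset.sum_eq_single i]
  · intro j _ hj
    by_contra h0
    have hv' : v ∈ (c j).support := Finsupp.mem_support_iff.2 h0
    rcases lt_or_gt_of_ne hj with h | h
    · exact lt_irrefl _ (hc.2 j i h v hv' v hv)
    · exact lt_irrefl _ (hc.2 i j h v hv v hv')
  · exact fun h => absurd (Finset.mem_univ i) h

theorem exists_mem_support_of_sum {k : ℕ} {c : Fin k → ℕ →₀ ℝ} {v : ℕ}
    (hv : v ∈ (∑ j, c j).support) : ∃ i, v ∈ (c i).support := by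
  by_contra hcon
  push Not at hcon
  refine Finsupp.mem_support_iff.1 hv ?_
  rw [Finsupp.finsetSum_apply]
  exact Finset.sum_eq_zero fun j _ => Finsupp.notMem_support_iff.1 (hcon j)

/-- The floor map in the set of minima is a label that cuts the sum back into the given blocks. -/
theorem LabelEstimate.lowerEstimate {F : Set (Finset ℕ)} {P : Seminorm ℝ (ℕ →₀ ℝ)} {δ : ℝ}
    (h : LabelEstimate F P δ) : LowerEstimate F P δ := by
  intro k c hc hF
  set M := Finset.univ.image (fun i => minOf (c i).support) with hM
  have hfl : ∀ i, ∀ v ∈ (c i).support, floorIn M v = minOf (c i).support := fun i v hv =>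
    Successive.floorIn_eq hc hv
  have hsupp : ∀ i, ∀ v ∈ (c i).support, v ∈ (∑ j, c j).support := fun i v hv => by
    rw [Finsupp.mem_support_iff, hc.sum_apply hv]
    exact Finsupp.mem_support_iff.1 hv
  have hinj : Function.Injective fun i => minOf (c i).support :=
    (Successive.minOf_strictMono hc).injective
  have himg : (∑ j, c j).support.image (floorIn M) = M := by
    refine image_floorIn ?_ ?_
    · intro m hm
      obtain ⟨i, -, rfl⟩ := Finset.mem_image.1 hm
      exact hsupp i _ (minOf_mem (hc.1 i))
    · intro v hv
      obtain ⟨i, hi⟩ := exists_mem_support_of_sum hv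
      rw [hfl i v hi]
      exact Finset.mem_image_of_mem _ (Finset.mem_univ i)
  have key := h (∑ j, c j) (floorIn M) ((floorIn_mono M).monotoneOn _)
    (fun i _ => floorIn_le M i) (by rw [himg]; exact hF)
  rw [himg, hM, Finset.sum_image fun i _ j _ hij => hinj hij] at key
  convert key using 3 with i
  congr 1
  ext v
  rw [Finsupp.filter_apply]
  split_ifs with hv
  · by_cases hvi : v ∈ (c i).support
    · exact (hc.sum_apply hvi).symm
    · rw [Finsupp.notMem_support_iff.1 hvi]
      by_contra h0
      obtain ⟨j, hj⟩ := exists_mem_support_of_sum (Finsupp.mem_support_iff.2 (Ne.symm h0))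
      rw [← hM, hfl j v hj] at hv
      exact hvi (hinj hv ▸ hj)
  · by_contra h0
    exact hv (hfl i v (Finsupp.mem_support_iff.2 h0))

/-- Group the labels by their floors in `M`: the `G`-estimate separates the groups, and the
`F`-estimate separates the pieces inside each group, so the constants multiply. -/
theorem LabelEstimate.comp {F G : Set (Finset ℕ)} {P : Seminorm ℝ (ℕ →₀ ℝ)} {δ ε : ℝ}
    (hδ : 0 ≤ δ) (hG : LabelEstimate G P δ) (hGr : Regular G)
    (hF : LabelEstimate F P ε) : LabelEstimate (comp G F) P (δ * ε) := by
  intro y g hg hle hy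
  obtain ⟨M, hM, hMA, hAM, hMF⟩ := exists_floorIn_of_mem_comp hy
  have hgi : ∀ i ∈ y.support, g i ∈ y.support.image g := fun i hi => Finset.mem_image_of_mem g hi
  set h : ℕ → ℕ := fun i => floorIn M (g i) with hh
  have himg : y.support.image h ⊆ M := by
    intro m hm
    obtain ⟨i, hi, rfl⟩ := Finset.mem_image.1 hm
    exact hAM _ (hgi i hi)
  have h1 := hG y h (fun i hi j hj hij => floorIn_mono M (hg hi hj hij))
    (fun i hi => (floorIn_le M _).trans (hle i hi)) (hGr.mono hM himg)
  have h2 : ∀ l ∈ y.support.image h,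
      ε * ∑ m ∈ (y.support.image g).filter (fun m => floorIn M m = l),
        P (y.filter fun i => g i = m) ≤ P (y.filter fun i => h i = l) := by
    intro l hl
    have hsub : ∀ i ∈ (y.filter fun i => h i = l).support, i ∈ y.support ∧ h i = l :=
      fun i hi => mem_support_filter.1 hi
    have hi2 : (y.filter fun i => h i = l).support.image g =
        (y.support.image g).filter (fun m => floorIn M m = l) := by
      ext m
      simp only [Finset.mem_image, Finset.mem_filter, mem_support_filter]
      constructor
      · rintro ⟨i, ⟨hi, hil⟩, rfl⟩
        exact ⟨⟨i, hi, rfl⟩, hil⟩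
      · rintro ⟨⟨i, hi, rfl⟩, hil⟩
        exact ⟨i, ⟨hi, hil⟩, rfl⟩
    have := hF (y.filter fun i => h i = l) g
      (fun i hi j hj hij => hg (hsub i hi).1 (hsub j hj).1 hij)
      (fun i hi => hle i (hsub i hi).1) (by rw [hi2]; exact hMF l (himg hl))
    rw [hi2] at this
    refine le_trans (le_of_eq ?_) this
    congr 1
    refine Finset.sum_congr rfl fun m hm => ?_
    congr 1
    ext v
    simp only [Finsupp.filter_apply]
    split_ifs with hv hv'
    · rfl
    · exact absurd (by rw [hh]; simp only [hv]; exact (Finset.mem_filter.1 hm).2) hv'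
    · rfl
  have h3 : ∑ l ∈ y.support.image h, ∑ m ∈ (y.support.image g).filter (fun m => floorIn M m = l),
        P (y.filter fun i => g i = m) = ∑ m ∈ y.support.image g, P (y.filter fun i => g i = m) := by
    refine Finset.sum_fiberwise_of_maps_to (fun m hm => ?_) _
    obtain ⟨i, hi, rfl⟩ := Finset.mem_image.1 hm
    exact Finset.mem_image.2 ⟨i, hi, rfl⟩
  calc δ * ε * ∑ m ∈ y.support.image g, P (y.filter fun i => g i = m)
      = δ * ∑ l ∈ y.support.image h, ε * ∑ m ∈ (y.support.image g).filter
          (fun m => floorIn M m = l), P (y.filter fun i => g i = m) := by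
        rw [← Finset.mul_sum, h3, mul_assoc]
    _ ≤ δ * ∑ l ∈ y.support.image h, P (y.filter fun i => h i = l) :=
        mul_le_mul_of_nonneg_left (Finset.sum_le_sum h2) hδ
    _ ≤ P y := h1

theorem labelEstimate_schreierZero {P : Seminorm ℝ (ℕ →₀ ℝ)} : LabelEstimate schreierZero P 1 := by
  intro y g hg hle hy
  rw [one_mul]
  rcases (y.support.image g).eq_empty_or_nonempty with h | ⟨m, hm⟩
  · rw [h, Finset.sum_empty]; exact apply_nonneg P y
  · have : y.support.image g = {m} :=
      Finset.eq_singleton_iff_unique_mem.2 ⟨hm, fun x hx => Finset.card_le_one.1 hy x hx m hm⟩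
    have hs := sum_filter_label y g _ fun i hi => Finset.mem_image_of_mem g hi
    rw [this, Finset.sum_singleton] at hs ⊢
    rw [hs]

theorem LabelEstimate.iter {F : Set (Finset ℕ)} {P : Seminorm ℝ (ℕ →₀ ℝ)} {δ : ℝ}
    (hδ : 0 ≤ δ) (h : LabelEstimate F P δ) (hF : Regular F) (n : ℕ) :
    LabelEstimate (iter F n) P (δ ^ n) := by
  induction n with
  | zero => rw [pow_zero]; exact labelEstimate_schreierZero
  | succ n ih => rw [pow_succ']; exact h.comp hδ hF ih

/-! ### Sums over systems of intervals -/

/-- The restriction of a vector to the interval `[a, b)`. -/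
def cut (a b : ℕ) : (ℕ →₀ ℝ) →ₗ[ℝ] (ℕ →₀ ℝ) where
  toFun y := y.filter fun i => a ≤ i ∧ i < b
  map_add' _ _ := Finsupp.filter_add
  map_smul' _ _ := Finsupp.filter_smul

theorem cut_apply (a b : ℕ) (y : ℕ →₀ ℝ) (v : ℕ) :
    cut a b y v = if a ≤ v ∧ v < b then y v else 0 :=
  Finsupp.filter_apply _ _ _

/-- The pairs `(a, b) ∈ I` describe disjoint nonempty intervals `[a, b)` with left end points
forming a set in `F`. -/
def IsIntervalSystem (F : Set (Finset ℕ)) (I : Finset (ℕ × ℕ)) : Prop :=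
  (∀ u ∈ I, u.1 < u.2) ∧ (∀ u ∈ I, ∀ v ∈ I, u ≠ v → u.2 ≤ v.1 ∨ v.2 ≤ u.1) ∧
    I.image Prod.fst ∈ F

theorem IsIntervalSystem.eq_of_mem {F : Set (Finset ℕ)} {I : Finset (ℕ × ℕ)}
    (hI : IsIntervalSystem F I) {u v : ℕ × ℕ} (hu : u ∈ I) (hv : v ∈ I) {i : ℕ}
    (hiu : u.1 ≤ i ∧ i < u.2) (hiv : v.1 ≤ i ∧ i < v.2) : u = v := by
  by_contra hne
  rcases hI.2.1 u hu v hv hne with h | h <;> omega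

/-- Sums over interval systems are controlled by the norm, the gaps between the intervals being
treated as additional blocks. -/
theorem LabelEstimate.sum_cut_le {F : Set (Finset ℕ)} (hF : Regular F)
    {P : Seminorm ℝ (ℕ →₀ ℝ)} {δ : ℝ} (hδ : 0 ≤ δ)
    (h : LabelEstimate (AsymptoticL1.comp F atMostTwo) P δ)
    {I : Finset (ℕ × ℕ)} (hI : IsIntervalSystem F I) (y : ℕ →₀ ℝ) :
    ∃ a : ℕ, δ * ∑ u ∈ I, P (cut u.1 u.2 y) ≤ P (y.filter fun i => a ≤ i) := by
  rcases I.eq_empty_or_nonempty with rfl | ⟨u₀, hu₀⟩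
  · exact ⟨0, by simp⟩
  set M := I.image Prod.fst with hM
  have hfst : ∀ u ∈ I, u.1 ∈ M := fun u hu => Finset.mem_image_of_mem Prod.fst hu
  have hinj : ∀ u ∈ I, ∀ v ∈ I, u.1 = v.1 → u = v := fun u hu v hv huv =>
    hI.eq_of_mem hu hv (i := u.1) ⟨le_rfl, hI.1 u hu⟩ ⟨huv.ge, huv ▸ hI.1 v hv⟩
  have hb : ∃ b : ℕ → ℕ, ∀ u ∈ I, b u.1 = u.2 := by
    have : ∀ m, ∃ b, ∀ u ∈ I, u.1 = m → b = u.2 := fun m => by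
      by_cases hm : ∃ u ∈ I, u.1 = m
      · obtain ⟨u, hu, rfl⟩ := hm
        exact ⟨u.2, fun v hv hvu => by rw [hinj v hv u hu hvu]⟩
      · exact ⟨0, fun u hu hum => absurd ⟨u, hu, hum⟩ hm⟩
    choose b hb using this
    exact ⟨b, fun u hu => hb _ u hu rfl⟩
  obtain ⟨b, hb⟩ := hb
  have hlt : ∀ m ∈ M, m < b m := fun m hm => by
    obtain ⟨u, hu, rfl⟩ := Finset.mem_image.1 hm
    rw [hb u hu]; exact hI.1 u hu
  have hsep : ∀ m ∈ M, ∀ m' ∈ M, m < m' → b m ≤ m' := fun m hm m' hm' hmm => by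
    obtain ⟨u, hu, rfl⟩ := Finset.mem_image.1 hm
    obtain ⟨v, hv, rfl⟩ := Finset.mem_image.1 hm'
    rw [hb u hu]
    rcases hI.2.1 u hu v hv (fun h => by rw [h] at hmm; exact lt_irrefl _ hmm) with h | h
    · exact h
    · have := hI.1 v hv; omega
  have hMne : M.Nonempty := ⟨_, hfst u₀ hu₀⟩
  set a := minOf M with ha
  have haM : a ∈ M := minOf_mem hMne
  refine ⟨a, ?_⟩
  -- Coordinates before the first left end point have no admissible label; dropping them is the
  -- reason for the tail in the conclusion.
  set z := y.filter fun i => a ≤ i with hz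
  have hflM : ∀ i, a ≤ i → floorIn M i ∈ M := fun i hi => floorIn_mem haM hi
  -- Inside `[m, b m)` the label is `m`, in the gap that follows it is `b m`. Over each `m` there
  -- are thus at most two labels, which is where `atMostTwo` enters.
  set g : ℕ → ℕ := fun i => if i < b (floorIn M i) then floorIn M i else b (floorIn M i) with hg
  have hgle : ∀ i, g i ≤ i := fun i => by
    have := floorIn_le M i
    simp only [hg]; split_ifs <;> omega
  have hgge : ∀ i, a ≤ i → floorIn M i ≤ g i := fun i hi => by
    have := hlt _ (hflM i hi)
    simp only [hg]; split_ifs <;> omega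
  have hgmax : ∀ i, a ≤ i → g i ≤ b (floorIn M i) := fun i hi => by
    have := hlt _ (hflM i hi)
    simp only [hg]; split_ifs <;> omega
  have hflg : ∀ i, a ≤ i → floorIn M (g i) = floorIn M i := fun i hi =>
    floorIn_eq (hflM i hi) (hgge i hi) fun m' hm' hle => le_floorIn hm' (hle.trans (hgle i))
  have hzs : ∀ i ∈ z.support, a ≤ i := fun i hi => (mem_support_filter.1 hi).2
  have key := h z g ?_ (fun i _ => hgle i) ?_
  · refine le_trans (mul_le_mul_of_nonneg_left ?_ hδ) key
    have e1 : ∑ u ∈ I, P (cut u.1 u.2 y) = ∑ m ∈ M, P (cut m (b m) y) := by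
      rw [hM, Finset.sum_image fun u hu v hv huv => hinj u hu v hv huv]
      exact Finset.sum_congr rfl fun u hu => by rw [hb u hu]
    have e2 : ∀ m ∈ M, cut m (b m) y = z.filter fun i => g i = m := fun m hm => by
      ext v
      rw [cut_apply, Finsupp.filter_apply, hz, Finsupp.filter_apply]
      by_cases hv : m ≤ v ∧ v < b m
      · have hav : a ≤ v := (minOf_le hm).trans hv.1
        have hfl : floorIn M v = m := floorIn_eq hm hv.1 fun m' hm' hle => by
          by_contra hcon
          have := hsep m hm m' hm' (not_le.1 hcon)
          omega
        rw [if_pos hv, if_pos, if_pos hav]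
        simp only [hg, hfl, if_pos hv.2]
      · rw [if_neg hv]
        split_ifs with h1 h2
        · exfalso
          have h3 := floorIn_le M v
          have h4 := hflM v h2
          have h5 : floorIn M v = m := by
            rw [← floorIn_self hm, ← h1, hflg v h2]
          have h6 := hlt _ h4
          simp only [hg] at h1
          split_ifs at h1 with h7
          · rw [h5] at h3 h7
            exact hv ⟨h3, h7⟩
          · omega
        · rfl
        · rfl
    rw [e1, Finset.sum_congr rfl fun m hm => by rw [e2 m hm]]
    rw [← Finset.sum_filter_of_ne (p := fun m => m ∈ z.support.image g)]
    · exact Finset.sum_le_sum_of_subset_of_nonneg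
        (fun m hm => (Finset.mem_filter.1 hm).2) fun _ _ _ => apply_nonneg P _
    · intro m _ hne
      by_contra hcon
      refine hne ?_
      rw [(Finsupp.filter_eq_zero_iff _ _).2, map_zero]
      intro v hv
      by_contra h0
      exact hcon (hv ▸ Finset.mem_image_of_mem g (Finsupp.mem_support_iff.2 h0))
  · intro i hi j hj hij
    have hi := hzs i hi
    have hj := hzs j hj
    rcases (floorIn_mono M hij).eq_or_lt with h | h
    · simp only [hg, h]
      have := hlt _ (hflM j hj)
      split_ifs <;> omega
    · exact (hgmax i hi).trans ((hsep _ (hflM i hi) _ (hflM j hj) h).trans (hgge j hj))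
  · refine mem_comp_of_label hF (g := floorIn M) ((floorIn_mono M).monotoneOn _)
      (fun i _ => floorIn_le M i) (hF.mono hI.2.2 ?_) ?_
    · intro m hm
      obtain ⟨j, hj, rfl⟩ := Finset.mem_image.1 hm
      obtain ⟨i, hi, rfl⟩ := Finset.mem_image.1 hj
      rw [hflg i (hzs i hi)]
      exact hflM i (hzs i hi)
    · intro m _
      refine (Finset.card_le_card (t := {m, b m}) ?_).trans Finset.card_le_two
      intro v hv
      obtain ⟨hv, hvm⟩ := Finset.mem_filter.1 hv
      obtain ⟨i, hi, rfl⟩ := Finset.mem_image.1 hv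
      rw [hflg i (hzs i hi)] at hvm
      simp only [hg, hvm, Finset.mem_insert, Finset.mem_singleton]
      split_ifs <;> simp

/-! ### Norms given by interval systems -/

/-- The supremum of `∑ P (y|_I)` over all interval systems with left end points in `F`. -/
def intervalNorm (F : Set (Finset ℕ)) (P : Seminorm ℝ (ℕ →₀ ℝ)) : Seminorm ℝ (ℕ →₀ ℝ) :=
  ⨆ I : {I // IsIntervalSystem F I}, ∑ u ∈ I.1, P.comp (cut u.1 u.2)

/-- The sums over interval systems are bounded by `K` times the norm. -/
def IntervalBound (F : Set (Finset ℕ)) (P : Seminorm ℝ (ℕ →₀ ℝ)) (K : ℝ) : Prop :=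
  ∀ I, IsIntervalSystem F I → ∀ y, ∑ u ∈ I, P (cut u.1 u.2 y) ≤ K * P y

theorem sum_comp_cut_apply (P : Seminorm ℝ (ℕ →₀ ℝ)) (I : Finset (ℕ × ℕ)) (y : ℕ →₀ ℝ) :
    (∑ u ∈ I, P.comp (cut u.1 u.2)) y = ∑ u ∈ I, P (cut u.1 u.2 y) := by
  rw [_root_.sum_apply]
  rfl

theorem isIntervalSystem_empty {F : Set (Finset ℕ)} (hF : ∅ ∈ F) : IsIntervalSystem F ∅ := by
  refine ⟨by simp, by simp, by simpa using hF⟩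

/-- A supremum of seminorms is computed pointwise only when the family is pointwise bounded;
`IntervalBound` provides this. -/
theorem intervalNorm_apply {F : Set (Finset ℕ)} {P : Seminorm ℝ (ℕ →₀ ℝ)} {K : ℝ}
    (h : IntervalBound F P K) (y : ℕ →₀ ℝ) :
    intervalNorm F P y = ⨆ I : {I // IsIntervalSystem F I}, ∑ u ∈ I.1, P (cut u.1 u.2 y) := by
  rw [intervalNorm, Seminorm.iSup_apply]
  · simp only [sum_comp_cut_apply]
  · rw [Seminorm.bddAbove_range_iff]
    intro y
    refine ⟨K * P y, ?_⟩
    rintro _ ⟨I, rfl⟩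
    simp only [sum_comp_cut_apply]
    exact h I.1 I.2 y

theorem sum_le_intervalNorm {F : Set (Finset ℕ)} {P : Seminorm ℝ (ℕ →₀ ℝ)} {K : ℝ}
    (h : IntervalBound F P K) {I : Finset (ℕ × ℕ)} (hI : IsIntervalSystem F I) (y : ℕ →₀ ℝ) :
    ∑ u ∈ I, P (cut u.1 u.2 y) ≤ intervalNorm F P y := by
  rw [intervalNorm_apply h]
  refine le_ciSup (f := fun I : {I // IsIntervalSystem F I} => ∑ u ∈ I.1, P (cut u.1 u.2 y))
    ⟨K * P y, ?_⟩ ⟨I, hI⟩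
  rintro _ ⟨I, rfl⟩
  exact h I.1 I.2 y

theorem intervalNorm_le {F : Set (Finset ℕ)} (hF : ∅ ∈ F) {P : Seminorm ℝ (ℕ →₀ ℝ)} {K : ℝ}
    (h : IntervalBound F P K) {y : ℕ →₀ ℝ} {C : ℝ}
    (hC : ∀ I, IsIntervalSystem F I → ∑ u ∈ I, P (cut u.1 u.2 y) ≤ C) :
    intervalNorm F P y ≤ C := by
  rw [intervalNorm_apply h]
  have : Nonempty {I // IsIntervalSystem F I} := ⟨⟨∅, isIntervalSystem_empty hF⟩⟩
  exact ciSup_le fun I => hC I.1 I.2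

theorem exists_lt_sum_of_lt_intervalNorm {F : Set (Finset ℕ)} (hF : ∅ ∈ F)
    {P : Seminorm ℝ (ℕ →₀ ℝ)} {K : ℝ} (h : IntervalBound F P K) {y : ℕ →₀ ℝ} {C : ℝ}
    (hC : C < intervalNorm F P y) :
    ∃ I, IsIntervalSystem F I ∧ C < ∑ u ∈ I, P (cut u.1 u.2 y) := by
  by_contra hcon
  push Not at hcon
  exact absurd hC (not_lt.2 (intervalNorm_le hF h hcon))

theorem tail_le_intervalNorm {F : Set (Finset ℕ)} {P : Seminorm ℝ (ℕ →₀ ℝ)} {K : ℝ}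
    (hs : ∀ i, {i} ∈ F) (h : IntervalBound F P K) (y : ℕ →₀ ℝ) (a : ℕ) :
    P (y.filter fun i => a ≤ i) ≤ intervalNorm F P y := by
  -- A single interval reaching past the support represents the tail.
  set b := max a (y.support.sup id) + 1 with hb
  have hI : IsIntervalSystem F {(a, b)} :=
    ⟨by simp only [Finset.mem_singleton, forall_eq]; omega, by simp, by simpa using hs a⟩
  refine le_trans (le_of_eq ?_) (sum_le_intervalNorm h hI y)
  rw [Finset.sum_singleton]
  congr 1
  ext v
  rw [cut_apply, Finsupp.filter_apply]
  by_cases hv : v ∈ y.support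
  · have : v ≤ y.support.sup id := Finset.le_sup (f := id) hv
    have hvb : v < b := by omega
    simp only [hvb, and_true]
  · rw [Finsupp.notMem_support_iff.1 hv]
    simp

theorem le_intervalNorm {F : Set (Finset ℕ)} {P : Seminorm ℝ (ℕ →₀ ℝ)} {K : ℝ}
    (hs : ∀ i, {i} ∈ F) (h : IntervalBound F P K) (y : ℕ →₀ ℝ) : P y ≤ intervalNorm F P y := by
  refine le_trans (le_of_eq ?_) (tail_le_intervalNorm hs h y 0)
  congr 1
  ext v
  simp

/-- An interval system can be cut down to an interval containing the support. -/
theorem IsIntervalSystem.trim {F : Set (Finset ℕ)} (hF : Regular F) {I : Finset (ℕ × ℕ)}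
    (hI : IsIntervalSystem F I) (P : Seminorm ℝ (ℕ →₀ ℝ)) {y : ℕ →₀ ℝ} {lo hi : ℕ}
    (hy : ∀ v ∈ y.support, lo ≤ v ∧ v < hi) :
    ∃ J, IsIntervalSystem F J ∧ (∀ u ∈ J, lo ≤ u.1 ∧ u.2 ≤ hi) ∧
      ∑ u ∈ J, P (cut u.1 u.2 y) = ∑ u ∈ I, P (cut u.1 u.2 y) := by
  -- Clip every interval to `[lo, hi)` and discard those that become empty. Left end points only
  -- move to the right, so their set remains in `F` by spreading.
  let φ : ℕ × ℕ → ℕ × ℕ := fun u => (max u.1 lo, min u.2 hi)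
  let I' := I.filter fun u => (φ u).1 < (φ u).2
  have hI' : ∀ u ∈ I', u ∈ I ∧ max u.1 lo < min u.2 hi := fun u hu => Finset.mem_filter.1 hu
  have hinj : ∀ u ∈ I', ∀ v ∈ I', (φ u).1 = (φ v).1 → u = v := by
    intro u hu v hv huv
    obtain ⟨hu, hu'⟩ := hI' u hu
    obtain ⟨hv, hv'⟩ := hI' v hv
    have huv' : max u.1 lo = max v.1 lo := huv
    exact hI.eq_of_mem hu hv (i := max u.1 lo) (by omega) (by omega)
  refine ⟨I'.image φ, ⟨?_, ?_, ?_⟩, ?_, ?_⟩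
  · intro w hw
    obtain ⟨u, hu, rfl⟩ := Finset.mem_image.1 hw
    exact (hI' u hu).2
  · intro w hw w' hw' hne
    obtain ⟨u, hu, rfl⟩ := Finset.mem_image.1 hw
    obtain ⟨v, hv, rfl⟩ := Finset.mem_image.1 hw'
    have : u ≠ v := fun h => hne (by rw [h])
    simp only [φ]
    rcases hI.2.1 u (hI' u hu).1 v (hI' v hv).1 this with h | h
    · left; omega
    · right; omega
  · have hch : ∀ w, ∃ f, ∀ u ∈ I', (φ u).1 = w → f = u.1 := fun w => by
      by_cases hw : ∃ u ∈ I', (φ u).1 = w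
      · obtain ⟨u, hu, rfl⟩ := hw
        exact ⟨u.1, fun v hv hvu => by rw [hinj v hv u hu hvu]⟩
      · exact ⟨0, fun u hu hum => absurd ⟨u, hu, hum⟩ hw⟩
    choose f hf using hch
    refine hF _ hI.2.2 _ f ?_ ?_
    · intro x hx y hy hxy
      simp only [Finset.coe_image, Set.mem_image, Finset.mem_coe] at hx hy
      obtain ⟨_, ⟨u, hu, rfl⟩, rfl⟩ := hx
      obtain ⟨_, ⟨v, hv, rfl⟩, rfl⟩ := hy
      rw [hf _ u hu rfl, hf _ v hv rfl]
      have hxy' : max u.1 lo < max v.1 lo := hxy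
      omega
    · intro x hx
      obtain ⟨_, hw, rfl⟩ := Finset.mem_image.1 hx
      obtain ⟨u, hu, rfl⟩ := Finset.mem_image.1 hw
      rw [hf _ u hu rfl]
      exact ⟨Finset.mem_image_of_mem Prod.fst (hI' u hu).1, le_max_left _ _⟩
  · intro w hw
    obtain ⟨u, hu, rfl⟩ := Finset.mem_image.1 hw
    exact ⟨le_max_right _ _, min_le_right _ _⟩
  · have hcut : ∀ u, cut (φ u).1 (φ u).2 y = cut u.1 u.2 y := fun u => by
      ext v
      rw [cut_apply, cut_apply]
      by_cases hv : v ∈ y.support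
      · obtain ⟨h1, h2⟩ := hy v hv
        have : ((φ u).1 ≤ v ∧ v < (φ u).2) ↔ (u.1 ≤ v ∧ v < u.2) := by
          simp only [φ]; omega
        simp only [this]
      · rw [Finsupp.notMem_support_iff.1 hv]; simp
    rw [Finset.sum_image fun u hu v hv huv => hinj u hu v hv (congrArg Prod.fst huv)]
    simp only [hcut]
    refine Finset.sum_subset (Finset.filter_subset _ _) fun u hu hu' => ?_
    rw [← hcut u]
    have : cut (φ u).1 (φ u).2 y = 0 := by
      ext v
      rw [cut_apply, if_neg]
      · rfl
      · intro h
        exact hu' (Finset.mem_filter.2 ⟨hu, h.1.trans_lt h.2⟩)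
    rw [this, map_zero]

/-- The interval norm for `G[F]` dominates `G`-admissible sums of the interval norm for `F`. -/
theorem sum_intervalNorm_le {F G : Set (Finset ℕ)} (hF : Regular F) (hF0 : ∅ ∈ F)
    (hG : Regular G) {P : Seminorm ℝ (ℕ →₀ ℝ)} {K K' : ℝ} (h : IntervalBound F P K)
    (h' : IntervalBound (comp G F) P K') {k : ℕ} {c : Fin k → ℕ →₀ ℝ} (hc : SuccessiveVectors c)
    (hcG : Admissible G c) :
    ∑ i, intervalNorm F P (c i) ≤ intervalNorm (comp G F) P (∑ i, c i) := by
  refine le_of_forall_pos_le_add fun ε hε => ?_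
  -- Choose nearly optimal systems for the blocks, with total error below `ε`; the denominator `k +
  -- 1` also covers `k = 0`. Trimmed to the ranges of the blocks, their union is a system for
  -- `G[F]`.
  have hε' : 0 < ε / (k + 1) := by positivity
  have hch : ∀ i, ∃ J, IsIntervalSystem F J ∧
      (∀ u ∈ J, minOf (c i).support ≤ u.1 ∧ u.2 ≤ (c i).support.sup id + 1) ∧
      intervalNorm F P (c i) - ε / (k + 1) ≤ ∑ u ∈ J, P (cut u.1 u.2 (c i)) := fun i => by
    obtain ⟨I, hI, hlt⟩ := exists_lt_sum_of_lt_intervalNorm hF0 h (sub_lt_self _ hε')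
    obtain ⟨J, hJ, hJ', hsum⟩ := hI.trim hF P (y := c i) (lo := minOf (c i).support)
      (hi := (c i).support.sup id + 1)
      fun v hv => ⟨minOf_le hv, Nat.lt_succ_of_le (Finset.le_sup (f := id) hv)⟩
    exact ⟨J, hJ, hJ', hsum ▸ hlt.le⟩
  choose J hJ hJb hJs using hch
  have hsupmem : ∀ i, (c i).support.sup id ∈ (c i).support := fun i => by
    obtain ⟨v, hv, hv'⟩ := Finset.exists_mem_eq_sup _ (hc.1 i) id
    rw [hv']; exact hv
  have hlohi : ∀ i j, i < j → (c i).support.sup id + 1 ≤ minOf (c j).support := fun i j hij =>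
    hc.2 i j hij _ (hsupmem i) _ (minOf_mem (hc.1 j))
  have hlt : ∀ i, ∀ u ∈ J i, u.1 < u.2 := fun i => (hJ i).1
  have hidx : ∀ i j, ∀ u ∈ J i, ∀ v ∈ J j, i < j → u.2 ≤ v.1 := fun i j u hu v hv hij =>
    (hJb i u hu).2.trans ((hlohi i j hij).trans (hJb j v hv).1)
  set M := Finset.univ.image (fun i => minOf (c i).support) with hM
  have hMi : ∀ i, minOf (c i).support ∈ M := fun i =>
    Finset.mem_image_of_mem (fun i => minOf (c i).support) (Finset.mem_univ i)
  have hmono := Successive.minOf_strictMono hc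
  -- The floor of a left end point identifies the block it comes from, and so serves as the label
  -- for `G[F]`.
  have hfl : ∀ i, ∀ u ∈ J i, floorIn M u.1 = minOf (c i).support := fun i u hu => by
    refine floorIn_eq (hMi i) (hJb i u hu).1 ?_
    intro m' hm' hle
    obtain ⟨j, -, rfl⟩ := Finset.mem_image.1 hm'
    rcases lt_or_ge i j with hij | hij
    · have h1 := hlohi i j hij
      have h2 := (hJb i u hu).2
      have h3 := hlt i u hu
      omega
    · exact hmono.monotone hij
  have hsys : IsIntervalSystem (comp G F) (Finset.univ.biUnion J) := by
    refine ⟨?_, ?_, ?_⟩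
    · intro u hu
      obtain ⟨i, -, hi⟩ := Finset.mem_biUnion.1 hu
      exact hlt i u hi
    · intro u hu v hv hne
      obtain ⟨i, -, hi⟩ := Finset.mem_biUnion.1 hu
      obtain ⟨j, -, hj⟩ := Finset.mem_biUnion.1 hv
      rcases lt_trichotomy i j with hij | rfl | hij
      · exact Or.inl (hidx i j u hi v hj hij)
      · exact (hJ i).2.1 u hi v hj hne
      · exact Or.inr (hidx j i v hj u hi hij)
    · refine mem_comp_of_label hG (g := floorIn M) ((floorIn_mono M).monotoneOn _)
        (fun i _ => floorIn_le M i) (hG.mono hcG ?_) ?_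
      · intro m hm
        obtain ⟨_, hw, rfl⟩ := Finset.mem_image.1 hm
        obtain ⟨u, hu, rfl⟩ := Finset.mem_image.1 hw
        obtain ⟨i, -, hi⟩ := Finset.mem_biUnion.1 hu
        rw [hfl i u hi]
        exact hMi i
      · intro m hm
        obtain ⟨_, hw, rfl⟩ := Finset.mem_image.1 hm
        obtain ⟨u, hu, rfl⟩ := Finset.mem_image.1 hw
        obtain ⟨i, -, hi⟩ := Finset.mem_biUnion.1 hu
        refine hF.mono (hJ i).2.2 ?_
        intro x hx
        obtain ⟨hx, hx'⟩ := Finset.mem_filter.1 hx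
        obtain ⟨v, hv, rfl⟩ := Finset.mem_image.1 hx
        obtain ⟨j, -, hj⟩ := Finset.mem_biUnion.1 hv
        rw [hfl i u hi, hfl j v hj] at hx'
        rw [hmono.injective hx'] at hj
        exact Finset.mem_image_of_mem Prod.fst hj
  have hcut : ∀ i, ∀ u ∈ J i, cut u.1 u.2 (∑ j, c j) = cut u.1 u.2 (c i) := fun i u hu => by
    ext v
    rw [cut_apply, cut_apply]
    split_ifs with hv
    · rw [Finsupp.finsetSum_apply]
      refine Finset.sum_eq_single i (fun j _ hji => ?_) fun h => absurd (Finset.mem_univ i) h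
      by_contra h0
      have hvj : v ∈ (c j).support := Finsupp.mem_support_iff.2 h0
      have h1 := minOf_le hvj
      have h2 : v ≤ (c j).support.sup id := Finset.le_sup (f := id) hvj
      have h3 := hJb i u hu
      rcases lt_or_gt_of_ne hji with hij | hij
      · have := hlohi j i hij; omega
      · have := hlohi i j hij; omega
    · rfl
  have hfinal := sum_le_intervalNorm h' hsys (∑ j, c j)
  rw [Finset.sum_biUnion] at hfinal
  · have h1 : ∑ i, ∑ u ∈ J i, P (cut u.1 u.2 (∑ j, c j)) =
        ∑ i, ∑ u ∈ J i, P (cut u.1 u.2 (c i)) :=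
      Finset.sum_congr rfl fun i _ => Finset.sum_congr rfl fun u hu => by rw [hcut i u hu]
    have h2 : ∑ i, intervalNorm F P (c i) - k * (ε / (k + 1)) ≤
        ∑ i, ∑ u ∈ J i, P (cut u.1 u.2 (c i)) := by
      have := Finset.sum_le_sum fun i (_ : i ∈ Finset.univ) => hJs i
      simpa [Finset.sum_sub_distrib] using this
    have h3 : k * (ε / (k + 1)) ≤ ε := by
      rw [mul_div_assoc', div_le_iff₀ (by positivity)]
      nlinarith
    linarith
  · intro i _ j _ hij
    refine Finset.disjoint_left.2 fun u hu hu' => ?_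
    have h1 := hlt i u hu
    rcases lt_or_gt_of_ne hij with h | h
    · have := hidx i j u hu u hu' h; omega
    · have := hidx j i u hu' u hu h; omega

theorem singleton_mem_iter {F : Set (Finset ℕ)} (hF : Regular F) (hs : ∀ i, {i} ∈ F) (n i : ℕ) :
    {i} ∈ iter F n := by
  induction n with
  | zero => simp [iter, schreierZero]
  | succ n ih => exact subset_comp hF hs ih

theorem iter_subset_iter {F : Set (Finset ℕ)} (hF : Regular F) (hs : ∀ i, {i} ∈ F) :
    Monotone (iter F) :=
  monotone_nat_of_le_succ fun _ => subset_comp hF hs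

/-- A lower estimate with constant `t ^ n` on the `n`-th iterate of `F` can be turned, by an
equivalent renorming, into a lower estimate with constant `t` on `F`. -/
theorem exists_renorming {F : Set (Finset ℕ)} (hF : Regular F) (hs : ∀ i, {i} ∈ F)
    {P : Seminorm ℝ (ℕ →₀ ℝ)} {K t : ℝ} {n : ℕ} (hn : n ≠ 0) (ht : 0 < t)
    (hK : ∀ y a, P (y.filter fun i => a ≤ i) ≤ K * P y)
    (h : LabelEstimate (comp (iter F n) atMostTwo) P (t ^ n)) :
    ∃ Q : Seminorm ℝ (ℕ →₀ ℝ), (∀ y, P y ≤ Q y) ∧ (∃ B, ∀ y, Q y ≤ B * P y) ∧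
      LowerEstimate F Q t := by
  have htn : 0 < t ^ n := pow_pos ht n
  have hit := regular_iter hF
  have hits := singleton_mem_iter hF hs
  have hit0 : ∀ j, ∅ ∈ iter F j := fun j => (hit j).mono (hits j 0) (by simp)
  have hbound : ∀ j ≤ n, ∀ I, IsIntervalSystem (iter F j) I → ∀ y,
      ∃ a : ℕ, t ^ n * ∑ u ∈ I, P (cut u.1 u.2 y) ≤ P (y.filter fun i => a ≤ i) := by
    intro j hj I hI y
    refine (h.sum_cut_le (hit n) htn.le (I := I) ⟨hI.1, hI.2.1, ?_⟩ y)
    exact iter_subset_iter hF hs hj hI.2.2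
  have hIB : ∀ j ≤ n, IntervalBound (iter F j) P (K / t ^ n) := fun j hj I hI y => by
    obtain ⟨a, ha⟩ := hbound j hj I hI y
    rw [div_mul_eq_mul_div, le_div_iff₀ htn, mul_comm]
    exact ha.trans (hK y a)
  set q : ℕ → Seminorm ℝ (ℕ →₀ ℝ) := fun j => intervalNorm (iter F j) P with hq
  -- The given estimate controls interval sums only by the norm of a tail. Since `q 0` dominates `P`
  -- on every tail, no constant is lost, as would happen with `P` itself in place of `q 0`.
  have hq0 : ∀ y, t ^ n * q n y ≤ q 0 y := fun y => by
    rw [mul_comm, ← le_div_iff₀ htn]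
    refine intervalNorm_le (hit0 n) (hIB n le_rfl) fun I hI => ?_
    obtain ⟨a, ha⟩ := hbound n le_rfl I hI y
    rw [le_div_iff₀ htn, mul_comm]
    exact ha.trans (tail_le_intervalNorm (hits 0) (hIB 0 (Nat.zero_le n)) y a)
  have hsup : ∀ j, j < n → ∀ (k : ℕ) (c : Fin k → ℕ →₀ ℝ), SuccessiveVectors c →
      Admissible F c → ∑ i, q j (c i) ≤ q (j + 1) (∑ i, c i) := fun j hj k c hc hcF =>
    sum_intervalNorm_le (hit j) (hit0 j) hF (hIB j hj.le) (hIB (j + 1) hj) hc hcF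
  obtain ⟨m, rfl⟩ := Nat.exists_eq_succ_of_ne_zero hn
  let T : ℕ → NNReal := fun j => ⟨t ^ j, (pow_pos ht j).le⟩
  -- With weights `t ^ j`, passing from `q j` to `q (j + 1)` costs exactly the factor `t`; the last
  -- term returns to `q 0` through `hq0`.
  let Q : Seminorm ℝ (ℕ →₀ ℝ) := ∑ j ∈ Finset.range (m + 1), T j • q j
  have hQ : ∀ y, Q y = ∑ j ∈ Finset.range (m + 1), t ^ j * q j y := fun y => by
    simp only [Q]
    rw [_root_.sum_apply]
    rfl
  refine ⟨Q, fun y => ?_, ⟨∑ j ∈ Finset.range (m + 1), t ^ j * (K / t ^ (m + 1)), fun y => ?_⟩, ?_⟩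
  · rw [hQ, Finset.sum_range_succ']
    have h1 := le_intervalNorm (hits 0) (hIB 0 (Nat.zero_le _)) y
    have h2 : 0 ≤ ∑ j ∈ Finset.range m, t ^ (j + 1) * q (j + 1) y :=
      Finset.sum_nonneg fun j _ => mul_nonneg (pow_pos ht _).le (apply_nonneg _ _)
    simp only [pow_zero, one_mul]
    linarith
  · rw [hQ, Finset.sum_mul]
    refine Finset.sum_le_sum fun j hj => ?_
    rw [mul_assoc]
    have hj' : j ≤ m + 1 := (Finset.mem_range.1 hj).le
    exact mul_le_mul_of_nonneg_left (intervalNorm_le (hit0 j) (hIB j hj') fun I hI =>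
      hIB j hj' I hI y) (pow_pos ht j).le
  · intro k c hc hcF
    set y := ∑ i, c i with hy
    simp only [hQ]
    -- Pair index `j` on the left with `j + 1` on the right, and the last index `m` on the left with
    -- `0` on the right.
    rw [Finset.sum_comm, Finset.mul_sum, Finset.sum_range_succ, Finset.sum_range_succ' _ m]
    refine add_le_add (Finset.sum_le_sum fun j hj => ?_) ?_
    · rw [← Finset.mul_sum, ← mul_assoc, ← pow_succ']
      exact mul_le_mul_of_nonneg_left
        (hsup j ((Finset.mem_range.1 hj).trans (Nat.lt_succ_self m)) k c hc hcF) (pow_pos ht _).le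
    · rw [← Finset.mul_sum, ← mul_assoc, ← pow_succ', pow_zero, one_mul]
      exact (mul_le_mul_of_nonneg_left (hsup m (Nat.lt_succ_self m) k c hc hcF) htn.le).trans
        (hq0 y)

/-! ### Asymptotic constants, subsequences and renorming of the space -/

section Constants

variable {X : Type*} [NormedAddCommGroup X] [NormedSpace ℝ X]

/-- The seminorm on coefficient vectors induced by a seminorm on the space and a sequence. -/
def pull (p : Seminorm ℝ X) (x : ℕ → X) : Seminorm ℝ (ℕ →₀ ℝ) :=
  p.comp (Finsupp.linearCombination ℝ x)

theorem pull_apply (p : Seminorm ℝ X) (x : ℕ → X) (c : ℕ →₀ ℝ) : pull p x c = p (comb x c) := rfl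

theorem comb_sum (x : ℕ → X) {k : ℕ} (c : Fin k → ℕ →₀ ℝ) :
    comb x (∑ i, c i) = ∑ i, comb x (c i) :=
  map_sum (Finsupp.linearCombination ℝ x) _ _

theorem comb_single (x : ℕ → X) (i : ℕ) (r : ℝ) : comb x (Finsupp.single i r) = r • x i :=
  Finsupp.linearCombination_single ℝ r i

theorem lowerEstimate_pull_iff {F : Set (Finset ℕ)} {p : Seminorm ℝ X} {x : ℕ → X} {δ : ℝ} :
    LowerEstimate F (pull p x) δ ↔ ∀ (k : ℕ) (c : Fin k → ℕ →₀ ℝ), SuccessiveVectors c →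
      Admissible F c → δ * ∑ i, p (comb x (c i)) ≤ p (∑ i, comb x (c i)) := by
  simp only [LowerEstimate, pull_apply, comb_sum]

theorem lowerEstimate_le_one {F : Set (Finset ℕ)} (hs : ∀ i, {i} ∈ F) {p : Seminorm ℝ X}
    {x : ℕ → X} (hx : 0 < p (x 0)) {δ : ℝ} (h : LowerEstimate F (pull p x) δ) : δ ≤ 1 := by
  have := h 1 (fun _ => Finsupp.single 0 1) ⟨fun _ => by simp,
    fun i j hij => absurd hij (by simp [Subsingleton.elim i j])⟩
    (by simpa [Admissible] using hs _)
  simp only [Finset.univ_unique, Finset.sum_singleton, pull_apply, comb_single, one_smul] at this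
  by_contra hcon
  nlinarith

theorem delta_nonneg (F : Set (Finset ℕ)) (p : Seminorm ℝ X) (x : ℕ → X) : 0 ≤ delta F p x :=
  Real.sSup_nonneg fun _ h => h.1

theorem le_delta {F : Set (Finset ℕ)} (hs : ∀ i, {i} ∈ F) {p : Seminorm ℝ X} {x : ℕ → X}
    (hx : 0 < p (x 0)) {δ : ℝ} (hδ : 0 ≤ δ) (h : LowerEstimate F (pull p x) δ) :
    δ ≤ delta F p x :=
  le_csSup ⟨1, fun _ h' => lowerEstimate_le_one hs hx (lowerEstimate_pull_iff.2 h'.2)⟩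
    ⟨hδ, lowerEstimate_pull_iff.1 h⟩

theorem delta_le_one {F : Set (Finset ℕ)} (hs : ∀ i, {i} ∈ F) {p : Seminorm ℝ X} {x : ℕ → X}
    (hx : 0 < p (x 0)) : delta F p x ≤ 1 :=
  Real.sSup_le (fun _ h => lowerEstimate_le_one hs hx (lowerEstimate_pull_iff.2 h.2)) zero_le_one

/-- The supremum is attained: each block sequence with positive sum of norms bounds `δ` by a
quotient, and the remaining ones impose no condition. -/
theorem lowerEstimate_delta (F : Set (Finset ℕ)) (p : Seminorm ℝ X) (x : ℕ → X) :
    LowerEstimate F (pull p x) (delta F p x) := by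
  intro k c hc hF
  rcases (Finset.sum_nonneg fun i _ => apply_nonneg (pull p x) (c i) :
    0 ≤ ∑ i, pull p x (c i)).eq_or_lt with h | h
  · rw [← h, mul_zero]; exact apply_nonneg _ _
  · rw [← le_div_iff₀ h]
    refine Real.sSup_le (fun δ hδ => ?_) (div_nonneg (apply_nonneg _ _) h.le)
    rw [le_div_iff₀ h]
    exact lowerEstimate_pull_iff.2 hδ.2 k c hc hF

theorem LowerEstimate.mono_const {F : Set (Finset ℕ)} {P : Seminorm ℝ (ℕ →₀ ℝ)} {δ ε : ℝ}
    (h : LowerEstimate F P δ) (hε : ε ≤ δ) : LowerEstimate F P ε := fun k c hc hF =>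
  (mul_le_mul_of_nonneg_right hε (Finset.sum_nonneg fun _ _ => apply_nonneg _ _)).trans
    (h k c hc hF)

/-- Lower estimates transfer along embeddings of families. -/
theorem LowerEstimate.comp_subsequence {F G : Set (Finset ℕ)} {N : ℕ → ℕ} (hN : StrictMono N)
    (hFG : ∀ A ∈ F, A.image N ∈ G) {p : Seminorm ℝ X} {x : ℕ → X} {δ : ℝ}
    (h : LowerEstimate G (pull p x) δ) : LowerEstimate F (pull p (x ∘ N)) δ := by
  intro k c hc hF
  have hcomb : ∀ y, pull p (x ∘ N) y = pull p x (y.mapDomain N) := fun y => by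
    rw [pull_apply, pull_apply, comb, comb, Finsupp.linearCombination_mapDomain]
  have hsupp : ∀ i, ((c i).mapDomain N).support = (c i).support.image N := fun i =>
    Finsupp.mapDomain_support_of_injective hN.injective (c i)
  have hmin : ∀ i, minOf ((c i).mapDomain N).support = N (minOf (c i).support) := fun i => by
    rw [hsupp]
    refine le_antisymm (minOf_le (Finset.mem_image_of_mem N (minOf_mem (hc.1 i)))) ?_
    obtain ⟨v, hv, hv'⟩ := Finset.mem_image.1 (minOf_mem ((hc.1 i).image N))
    rw [← hv']
    exact hN.monotone (minOf_le hv)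
  have := h k (fun i => (c i).mapDomain N) ⟨fun i => ?_, ?_⟩ ?_
  · simp only [hcomb]
    rwa [Finsupp.mapDomain_finsetSum]
  · simp only [hsupp]; exact (hc.1 i).image N
  · intro i j hij m hm n hn
    simp only [hsupp] at hm hn
    obtain ⟨m', hm', rfl⟩ := Finset.mem_image.1 hm
    obtain ⟨n', hn', rfl⟩ := Finset.mem_image.1 hn
    exact hN (hc.2 i j hij m' hm' n' hn')
  · have := hFG _ hF
    rw [Finset.image_image] at this
    rw [Admissible]
    simp only [hmin]
    exact this

theorem IsBlockBasis.comp_strictMono {e x : ℕ → X} (h : IsBlockBasis e x) {N : ℕ → ℕ}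
    (hN : StrictMono N) : IsBlockBasis e (x ∘ N) := by
  obtain ⟨c, hc, hx⟩ := h
  exact ⟨c ∘ N, ⟨fun i => hc.1 (N i), fun i j hij => hc.2 _ _ (hN hij)⟩, fun i => hx (N i)⟩

theorem isBlockBasis_self (e : ℕ → X) : IsBlockBasis e e := by
  have hsupp : ∀ i, (Finsupp.single i 1 : ℕ →₀ ℝ).support = {i} := fun i => by simp
  refine ⟨fun i => Finsupp.single i 1, ⟨fun i => by simp, fun i j hij m hm n hn => ?_⟩,
    fun i => by rw [comb_single, one_smul]⟩
  simp only [hsupp, Finset.mem_singleton] at hm hn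
  rwa [hm, hn]

theorem IsBlockBasis.ne_zero {e x : ℕ → X} (he : LinearIndependent ℝ e) (h : IsBlockBasis e x)
    (i : ℕ) : x i ≠ 0 := by
  obtain ⟨c, hc, hx⟩ := h
  rw [hx i]
  intro h0
  have := linearIndependent_iff.1 he _ h0
  have hne := hc.1 i
  simp [this] at hne

theorem IsEquivalentNorm.pos {p : Seminorm ℝ X} (hp : IsEquivalentNorm p) {v : X} (hv : v ≠ 0) :
    0 < p v := by
  obtain ⟨A, B, hA, -, h⟩ := hp
  exact (mul_pos hA (norm_pos_iff.2 hv)).trans_le (h v).1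

theorem isEquivalentNorm_norm : IsEquivalentNorm (normSeminorm ℝ X) :=
  ⟨1, 1, one_pos, one_pos, fun x => by simp⟩

theorem deltaDot_nonneg (F : Set (Finset ℕ)) (p : Seminorm ℝ X) (e : ℕ → X) :
    0 ≤ deltaDot F p e :=
  Real.sSup_nonneg <| by rintro _ ⟨x, _, rfl⟩; exact delta_nonneg F p x

theorem deltaDDot_nonneg (F : Set (Finset ℕ)) (e : ℕ → X) : 0 ≤ deltaDDot F e :=
  Real.sSup_nonneg <| by rintro _ ⟨p, _, rfl⟩; exact deltaDot_nonneg F p e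

variable {e : ℕ → X} (he : LinearIndependent ℝ e)

include he in
theorem deltaDot_le_one {F : Set (Finset ℕ)} (hs : ∀ i, {i} ∈ F) {p : Seminorm ℝ X}
    (hp : IsEquivalentNorm p) : deltaDot F p e ≤ 1 :=
  Real.sSup_le (fun _ ⟨_, hx, h⟩ => h ▸ delta_le_one hs (hp.pos (hx.ne_zero he 0))) zero_le_one

include he in
theorem deltaDDot_le_one {F : Set (Finset ℕ)} (hs : ∀ i, {i} ∈ F) :
    deltaDDot F e ≤ 1 :=
  Real.sSup_le (fun _ ⟨_, hp, h⟩ => h ▸ deltaDot_le_one he hs hp) zero_le_one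

include he in
theorem le_deltaDDot {F : Set (Finset ℕ)} (hs : ∀ i, {i} ∈ F) {p : Seminorm ℝ X}
    (hp : IsEquivalentNorm p) {x : ℕ → X} (hx : IsBlockBasis e x) {δ : ℝ} (hδ : 0 ≤ δ)
    (h : LowerEstimate F (pull p x) δ) : δ ≤ deltaDDot F e := by
  refine (le_delta hs (hp.pos (hx.ne_zero he 0)) hδ h).trans ?_
  have h1 : delta F p x ≤ deltaDot F p e := le_csSup
    ⟨1, by rintro _ ⟨y, hy, rfl⟩; exact delta_le_one hs (hp.pos (hy.ne_zero he 0))⟩ ⟨x, hx, rfl⟩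
  have h2 : deltaDot F p e ≤ deltaDDot F e := le_csSup
    ⟨1, by rintro _ ⟨q, hq, rfl⟩; exact deltaDot_le_one he hs hq⟩ ⟨p, hp, rfl⟩
  exact h1.trans h2

theorem exists_of_lt_deltaDDot {F : Set (Finset ℕ)} {r : ℝ} (h : r < deltaDDot F e) :
    ∃ (p : Seminorm ℝ X) (x : ℕ → X), IsEquivalentNorm p ∧ IsBlockBasis e x ∧
      r < delta F p x := by
  obtain ⟨_, ⟨p, hp, rfl⟩, h⟩ := exists_lt_of_lt_csSup
    (by exact ⟨_, normSeminorm ℝ X, isEquivalentNorm_norm, rfl⟩) h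
  obtain ⟨_, ⟨x, hx, rfl⟩, h⟩ := exists_lt_of_lt_csSup
    (by exact ⟨_, e, isBlockBasis_self e, rfl⟩) h
  exact ⟨p, x, hp, hx, h⟩

-- An embedding of families is realised by passing to a subsequence, which is again a block basis.
include he in
theorem deltaDDot_anti {F G : Set (Finset ℕ)} (hF : ∀ i, {i} ∈ F) (h : Embeds F G) :
    deltaDDot G e ≤ deltaDDot F e := by
  by_contra hcon
  obtain ⟨p, x, hp, hx, hlt⟩ := exists_of_lt_deltaDDot (not_le.1 hcon)
  obtain ⟨N, hN, hFG⟩ := h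
  exact absurd (le_deltaDDot he hF hp (hx.comp_strictMono hN) (delta_nonneg G p x)
    ((lowerEstimate_delta G p x).comp_subsequence hN hFG)) (not_le.2 hlt)

-- Any estimate on `F` iterates to its `n`-th power on `iter F n`; near-optimal norms and block
-- bases then give the inequality between the suprema.
include he in
theorem deltaDDot_pow_le {F G : Set (Finset ℕ)} (hFr : Regular F) (hG : ∀ i, {i} ∈ G) {n : ℕ}
    (hn : n ≠ 0) (h : Embeds G (iter F n)) : deltaDDot F e ^ n ≤ deltaDDot G e := by
  by_contra hcon
  have h0 := deltaDDot_nonneg G e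
  have hlt : (deltaDDot G e) ^ ((n : ℝ)⁻¹) < deltaDDot F e := by
    by_contra hcon'
    have := pow_le_pow_left₀ (deltaDDot_nonneg F e) (not_lt.1 hcon') n
    rw [Real.rpow_inv_natCast_pow h0 hn] at this
    exact hcon this
  obtain ⟨p, x, hp, hx, hlt⟩ := exists_of_lt_deltaDDot hlt
  obtain ⟨N, hN, hFG⟩ := h
  have h1 := (((lowerEstimate_delta F p x).labelEstimate hFr).iter (delta_nonneg F p x)
    hFr n).lowerEstimate.comp_subsequence hN hFG
  have h2 := le_deltaDDot he hG hp (hx.comp_strictMono hN) (pow_nonneg (delta_nonneg F p x) n) h1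
  have h3 := pow_lt_pow_left₀ hlt (Real.rpow_nonneg h0 _) hn
  rw [Real.rpow_inv_natCast_pow h0 hn] at h3
  exact absurd h2 (not_le.2 h3)

/-- A seminorm on coefficient vectors which is equivalent to the norm of `X` extends to an
equivalent norm on `X`. -/
theorem exists_equivalentNorm_extension {x : ℕ → X} {Q : Seminorm ℝ (ℕ →₀ ℝ)} {A B : ℝ}
    (hA : 0 < A) (hB : 0 < B) (hAQ : ∀ y, A * ‖comb x y‖ ≤ Q y) (hQB : ∀ y, Q y ≤ B * ‖comb x y‖) :
    ∃ q : Seminorm ℝ X, IsEquivalentNorm q ∧ ∀ y, q (comb x y) = Q y := by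
  have comb_add : ∀ y z, comb x (y + z) = comb x y + comb x z := fun y z =>
    map_add (Finsupp.linearCombination ℝ x) y z
  have comb_sub : ∀ y z, comb x (y - z) = comb x y - comb x z := fun y z =>
    map_sub (Finsupp.linearCombination ℝ x) y z
  have comb_smul : ∀ (r : ℝ) y, comb x (r • y) = r • comb x y := fun r y =>
    map_smul (Finsupp.linearCombination ℝ x) r y
  have comb_zero : comb x 0 = 0 := map_zero (Finsupp.linearCombination ℝ x)
  -- Infimal convolution of `Q` with `B * ‖·‖`. Since `Q ≤ B * ‖·‖` on the span, the infimum at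
  -- `comb x y` is attained at `y`, so `f` extends `Q`.
  let f : X → ℝ := fun v => ⨅ y, (Q y + B * ‖v - comb x y‖)
  have hnn : ∀ v y, 0 ≤ Q y + B * ‖v - comb x y‖ := fun v y => by positivity
  have hbdd : ∀ v, BddBelow (Set.range fun y => Q y + B * ‖v - comb x y‖) := fun v =>
    ⟨0, by rintro _ ⟨y, rfl⟩; exact hnn v y⟩
  have hle : ∀ v y, f v ≤ Q y + B * ‖v - comb x y‖ := fun v y => ciInf_le (hbdd v) y
  have h0 : f 0 = 0 := by
    refine le_antisymm ?_ (le_ciInf fun y => hnn 0 y)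
    simpa [comb_zero] using hle 0 0
  have hadd : ∀ v w, f (v + w) ≤ f v + f w := fun v w => by
    refine le_ciInf_add_ciInf fun y z => (hle (v + w) (y + z)).trans ?_
    have h1 := map_add_le_add Q y z
    have h2 : ‖v + w - comb x (y + z)‖ ≤ ‖v - comb x y‖ + ‖w - comb x z‖ := by
      rw [comb_add, add_sub_add_comm]
      exact norm_add_le _ _
    nlinarith
  have hsmul : ∀ (r : ℝ) v, f (r • v) ≤ ‖r‖ * f v := fun r v => by
    have : ‖r‖ * f v = ⨅ y, ‖r‖ * (Q y + B * ‖v - comb x y‖) :=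
      Real.mul_iInf_of_nonneg (norm_nonneg r) _
    rw [this]
    refine le_ciInf fun y => (hle (r • v) (r • y)).trans (le_of_eq ?_)
    rw [comb_smul, ← smul_sub, norm_smul, map_smul_eq_mul]
    ring
  refine ⟨Seminorm.ofSMulLE f h0 hadd hsmul, ⟨min A B, B, lt_min hA hB, hB, fun v => ⟨?_, ?_⟩⟩,
    fun y => ?_⟩
  · refine le_ciInf fun y => ?_
    have h1 : ‖v‖ ≤ ‖comb x y‖ + ‖v - comb x y‖ := by
      have := norm_add_le (comb x y) (v - comb x y)
      rwa [_root_.add_sub_cancel] at this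
    have h2 : min A B * ‖comb x y‖ ≤ Q y :=
      (mul_le_mul_of_nonneg_right (min_le_left A B) (norm_nonneg _)).trans (hAQ y)
    have h3 : min A B * ‖v - comb x y‖ ≤ B * ‖v - comb x y‖ :=
      mul_le_mul_of_nonneg_right (min_le_right A B) (norm_nonneg _)
    have h4 := mul_le_mul_of_nonneg_left h1 (lt_min hA hB).le
    linarith
  · have := hle v 0
    simp only [map_zero, comb_zero, _root_.sub_zero, zero_add] at this
    exact this
  · change f (comb x y) = Q y
    refine le_antisymm (by simpa using hle (comb x y) y) (le_ciInf fun z => ?_)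
    have h1 := map_add_le_add Q z (y - z)
    have h2 := hQB (y - z)
    rw [_root_.add_sub_cancel] at h1
    rw [comb_sub] at h2
    linarith

/-- Tail projections are uniformly bounded on block subspaces. -/
theorem exists_tail_bound [CompleteSpace X] (b : SchauderBasis ℝ X) {x : ℕ → X}
    (hx : IsBlockBasis b x) :
    ∃ K : ℝ, 0 ≤ K ∧ ∀ y a, ‖comb x (y.filter fun i => a ≤ i)‖ ≤ K * ‖comb x y‖ := by
  obtain ⟨C, hC⟩ := SchauderBasis.exists_norm_proj_le b
  have hC0 : 0 ≤ C := (norm_nonneg _).trans (hC 0)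
  obtain ⟨c, hc, hxc⟩ := hx
  refine ⟨1 + C, by positivity, fun y a => ?_⟩
  -- The projection onto the first `m` basis vectors fixes the blocks before `a` and kills the
  -- others, so the tail is the identity minus this projection.
  set m := minOf (c a).support with hm
  have hproj : ∀ i, SchauderBasis.proj b m (x i) = if a ≤ i then 0 else x i := fun i => by
    rw [hxc i, comb, Finsupp.linearCombination_apply, Finsupp.sum, map_sum]
    have : ∀ j ∈ (c i).support, SchauderBasis.proj b m ((c i) j • b j) =
        if a ≤ i then 0 else (c i) j • b j := fun j hj => by
      rw [map_smul, SchauderBasis.proj_apply_basis_mem]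
      by_cases hai : a ≤ i
      · have hmj : m ≤ j := by
          rcases hai.eq_or_lt with rfl | h
          · exact minOf_le hj
          · exact (hc.2 a i h m (minOf_mem (hc.1 a)) j hj).le
        rw [if_pos hai, if_neg (not_lt.2 hmj), smul_zero]
      · rw [if_neg hai, if_pos (hc.2 i a (not_le.1 hai) j hj m (minOf_mem (hc.1 a)))]
    rw [Finset.sum_congr rfl this]
    split_ifs <;> simp
  have hdec : comb x (y.filter fun i => a ≤ i) = comb x y - SchauderBasis.proj b m (comb x y) := by
    induction y using Finsupp.induction_linear with
    | zero =>
      have h0 : (Finsupp.filter (fun i => a ≤ i) (0 : ℕ →₀ ℝ)) = 0 :=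
        (Finsupp.filter_eq_zero_iff _ _).2 (by simp)
      rw [h0]; simp [comb]
    | add y z hy hz =>
      have h1 : comb x (y + z) = comb x y + comb x z :=
        map_add (Finsupp.linearCombination ℝ x) y z
      have h2 : ∀ y z, comb x (y + z) = comb x y + comb x z := fun y z =>
        map_add (Finsupp.linearCombination ℝ x) y z
      rw [Finsupp.filter_add, h2, hy, hz, h1, map_add]
      abel
    | single i r =>
      rw [comb_single, map_smul, hproj]
      by_cases h : a ≤ i
      · rw [Finsupp.filter_single_of_pos _ h, if_pos h, comb_single]; simp
      · rw [Finsupp.filter_single_of_neg _ h, if_neg h]; simp [comb]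
  rw [hdec]
  refine (norm_sub_le _ _).trans ?_
  have := (SchauderBasis.proj b m).le_of_opNorm_le (hC m) (comb x y)
  linarith

/-- If a constant `d` for `G` exceeded the power, its root `t = d^(1/n)` would exceed the constant
of `F`; but renorming the block subspace and extending the norm to the space realises `t` on `F`. -/
theorem deltaDDot_le_pow [CompleteSpace X] (b : SchauderBasis ℝ X) {F G : Set (Finset ℕ)}
    (hFr : Regular F) (hF : ∀ i, {i} ∈ F) {n : ℕ} (hn : n ≠ 0)
    (h : Embeds (comp (iter F n) atMostTwo) G) : deltaDDot G b ≤ deltaDDot F b ^ n := by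
  have he := b.linearIndependent
  by_contra hcon
  obtain ⟨p, x, hp, hx, hlt⟩ := exists_of_lt_deltaDDot (not_le.1 hcon)
  set d := delta G p x with hd
  have hd0 : 0 ≤ d := delta_nonneg G p x
  have hF0 := deltaDDot_nonneg F b
  set t : ℝ := d ^ ((n : ℝ)⁻¹) with ht
  have htn : t ^ n = d := Real.rpow_inv_natCast_pow hd0 hn
  have hlt' : deltaDDot F b < t := lt_of_pow_lt_pow_left₀ n (Real.rpow_nonneg hd0 _) (htn ▸ hlt)
  have ht0 : 0 < t := hF0.trans_lt hlt'
  obtain ⟨N, hN, hNG⟩ := h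
  have hx' := hx.comp_strictMono hN
  obtain ⟨K, hK0, hK⟩ := exists_tail_bound b hx'
  obtain ⟨A, B, hA, hB, hAB⟩ := id hp
  have hest := ((lowerEstimate_delta G p x).comp_subsequence hN hNG).labelEstimate
    ((regular_iter hFr n).comp regular_atMostTwo)
  rw [← hd, ← htn] at hest
  obtain ⟨Q, hPQ, ⟨C, hQC⟩, hQ⟩ := exists_renorming hFr hF (K := B * K / A) hn ht0 (fun y a => by
    rw [pull_apply, pull_apply]
    have h1 := (hAB (comb (x ∘ N) (y.filter fun i => a ≤ i))).2
    have h2 := (hAB (comb (x ∘ N) y)).1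
    have h3 := hK y a
    rw [div_mul_eq_mul_div, le_div_iff₀ hA]
    calc p (comb (x ∘ N) (y.filter fun i => a ≤ i)) * A
        ≤ (B * (K * ‖comb (x ∘ N) y‖)) * A := by gcongr; exact h1.trans (by gcongr)
      _ = B * K * (A * ‖comb (x ∘ N) y‖) := by ring
      _ ≤ B * K * p (comb (x ∘ N) y) := by gcongr) hest
  obtain ⟨q, hq, hqQ⟩ := exists_equivalentNorm_extension (x := x ∘ N) (Q := Q) (A := A)
    (B := (|C| + 1) * B) hA (by positivity) (fun y => (hAB _).1.trans (hPQ y)) (fun y => by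
      have h1 := hQC y
      have h2 := (hAB (comb (x ∘ N) y)).2
      rw [pull_apply] at h1
      have h3 : C * p (comb (x ∘ N) y) ≤ (|C| + 1) * p (comb (x ∘ N) y) :=
        mul_le_mul_of_nonneg_right ((le_abs_self C).trans (by linarith)) (apply_nonneg _ _)
      calc Q y ≤ (|C| + 1) * p (comb (x ∘ N) y) := h1.trans h3
        _ ≤ (|C| + 1) * (B * ‖comb (x ∘ N) y‖) := by gcongr
        _ = _ := by ring)
  have hpull : pull q (x ∘ N) = Q := by ext y; exact hqQ y
  exact absurd (le_deltaDDot he hF hq hx' ht0.le (hpull ▸ hQ)) (not_le.2 hlt')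

end Constants

/-! ### Ranks of trees and the Schreier families -/

/-- A rank function on the tree of increasing enumerations of members of `S_α` has value at least
`α` at the root. -/
theorem le_rank_of_schreier {a : Ordinal.{0} → ℕ → Ordinal.{0}} (ha : IsLadderSystem a)
    {α : Ordinal.{0}} (hα : α < ω₁) (n : ℕ) (r : List ℕ → Ordinal.{0})
    (hr : ∀ l i, (l ++ [i]).Pairwise (· < ·) → (∀ j ∈ l ++ [i], n ≤ j) →
      (l ++ [i]).toFinset ∈ schreier a α → r (l ++ [i]) < r l) : α ≤ r [] := by
  induction α using Ordinal.limitRecOn generalizing n r with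
  | zero => exact bot_le
  | add_one α ih =>
    have hα' : α < ω₁ := (lt_add_one α).trans hα
    -- With `i ≥ 1` every two-element set with minimum `i` lies in `S_1`; hence `{i} ∪ G` lies in
    -- `S_{α+1}` for all `G ∈ S_α` beyond `i`. The subtree below `[i]` thus has rank at least `α`.
    set i := max n 1 with hi
    have h1 : α ≤ r [i] := by
      refine ih hα' (i + 1) (fun l => r (i :: l)) fun l j hl hge hmem => ?_
      refine hr (i :: l) j ?_ ?_ ?_
      · rw [List.cons_append, List.pairwise_cons]
        exact ⟨fun k hk => hge k hk, hl⟩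
      · intro k hk
        rw [List.cons_append, List.mem_cons] at hk
        rcases hk with rfl | hk
        · exact le_max_left _ _
        · have := hge k hk; omega
      · rw [List.cons_append, List.toFinset_cons, schreier_add_one]
        set G := (l ++ [j]).toFinset with hG
        have hGi : ∀ k ∈ G, i < k := fun k hk => hge k (List.mem_toFinset.1 hk)
        have hGne : G.Nonempty := ⟨j, by simp [hG]⟩
        have hmG := hGi _ (minOf_mem hGne)
        set g : ℕ → ℕ := fun k => if k = i then i else minOf G with hg
        have hgG : ∀ k ∈ G, g k = minOf G := fun k hk => if_neg (hGi k hk).ne'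
        have hgi : g i = i := if_pos rfl
        have hgim : ∀ k ∈ insert i G, g k = i ∨ g k = minOf G := fun k hk => by
          rcases Finset.mem_insert.1 hk with rfl | hk
          · exact Or.inl hgi
          · exact Or.inr (hgG k hk)
        refine mem_comp_of_label regular_schreierOne (g := g) ?_ ?_ ?_ ?_
        · intro x hx y hy hxy
          simp only [Finset.coe_insert, Set.mem_insert_iff, Finset.mem_coe] at hx hy
          rcases hx with rfl | hx <;> rcases hy with rfl | hy
          · exact le_rfl
          · rw [hgi, hgG y hy]; exact hmG.le
          · exact absurd (hGi x hx) (not_lt.2 hxy)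
          · rw [hgG x hx, hgG y hy]
        · intro k hk
          rcases Finset.mem_insert.1 hk with rfl | hk
          · exact hgi.le
          · rw [hgG k hk]; exact minOf_le hk
        · refine regular_schreierOne.mono (A := {i, minOf G}) ?_ fun m hm => ?_
          · intro k hk
            have h2 := Finset.card_le_two (a := i) (b := minOf G)
            have h3 : i ≤ k := by
              rcases Finset.mem_insert.1 hk with rfl | hk
              · exact le_rfl
              · rw [Finset.mem_singleton.1 hk]; exact hmG.le
            omega
          · obtain ⟨k, hk, rfl⟩ := Finset.mem_image.1 hm
            simpa using hgim k hk
        · intro m hm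
          obtain ⟨k, hk, rfl⟩ := Finset.mem_image.1 hm
          rcases hgim k hk with h | h
          · refine (regular_schreier a α).mono (singleton_mem_schreier ha hα' i) fun v hv => ?_
            obtain ⟨hv, hvk⟩ := Finset.mem_filter.1 hv
            rcases Finset.mem_insert.1 hv with rfl | hv
            · exact Finset.mem_singleton_self _
            · rw [hgG v hv, h] at hvk; omega
          · refine (regular_schreier a α).mono hmem fun v hv => ?_
            obtain ⟨hv, hvk⟩ := Finset.mem_filter.1 hv
            rcases Finset.mem_insert.1 hv with rfl | hv
            · rw [hgi, h] at hvk; omega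
            · exact hv
    have h2 : r [i] < r [] := by
      refine hr [] i (by simp) (by simp [hi]) ?_
      simpa using singleton_mem_schreier ha hα i
    exact Order.add_one_le_iff.2 (h1.trans_lt h2)
  | limit α hl ih =>
    by_contra hcon
    -- If the rank were below `α`, some ladder term would exceed it; members of that family beyond
    -- `m` belong to `S_α`, contradicting the induction hypothesis.
    obtain ⟨m, hm⟩ := ha.exists_le hα hl (hl.add_one_lt (not_le.1 hcon))
    have hlt := (ha α hα hl).2.1 m
    refine absurd (ih _ hlt (hlt.trans hα) (max n m) r fun l i h1 h2 h3 => ?_)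
      (not_le.2 (Order.add_one_le_iff.1 hm))
    refine hr l i h1 (fun j hj => (le_max_left n m).trans (h2 j hj)) ?_
    rw [mem_schreier_limit a hl]
    exact ⟨m, hlt, h3, fun j hj => (le_max_right n m).trans (h2 j (List.mem_toFinset.1 hj))⟩

/-- Ranks form an initial segment of the ordinals. A rank of at least `ω₁` would make the successor
of the supremum of all countable ranks, itself countable, a rank as well. -/
theorem rank_lt_omega_one {T : Type} [Countable T] (r : T → T → Prop) [IsWellFounded T r] (t : T) :
    IsWellFounded.rank r t < ω₁ := by
  by_contra hcon
  let g : T → Ordinal.{0} := fun s =>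
    if IsWellFounded.rank r s < ω₁ then IsWellFounded.rank r s else 0
  have hg : ∀ s, g s < ω₁ := fun s => by
    simp only [g]
    split_ifs with h
    · exact h
    · exact Ordinal.omega_pos 1
  have h1 : (⨆ s, g s) + 1 < ω₁ :=
    Ordinal.isPrincipal_add_omega 1 (Ordinal.iSup_lt_omega_one hg)
      (Ordinal.one_lt_omega0.trans Ordinal.omega0_lt_omega_one)
  obtain ⟨s, hs⟩ := IsWellFounded.mem_range_rank_of_le (h1.le.trans (not_lt.1 hcon))
  have h2 : g s = (⨆ s, g s) + 1 := by
    simp only [g, hs, if_pos h1]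
  have h3 : g s ≤ ⨆ s, g s := Ordinal.le_iSup g s
  rw [h2] at h3
  exact absurd h3 (not_le.2 (lt_add_one _))

/-! ### Sequences equivalent to the unit vector basis of `ℓ_1` -/

section Embedding

variable {X : Type*} [NormedAddCommGroup X] [NormedSpace ℝ X]

theorem lp_one_summable (f : lp (fun _ : ℕ => ℝ) 1) : Summable fun i => |f i| := by
  have := (lp.memℓp f).summable (by simp)
  simpa using this

theorem lp_one_norm (f : lp (fun _ : ℕ => ℝ) 1) : ‖f‖ = ∑' i, |f i| := by
  rw [lp.norm_eq_tsum_rpow (by simp)]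
  simp

theorem containsL1_of_sequence [CompleteSpace X] {z : ℕ → X} {C c : ℝ} (hc : 0 < c)
    (hz : ∀ i, ‖z i‖ ≤ C)
    (h : ∀ (a : ℕ → ℝ) (n : ℕ),
      c * ∑ i ∈ Finset.range n, |a i| ≤ ‖∑ i ∈ Finset.range n, a i • z i‖) :
    ContainsL1 X := by
  have hbound : ∀ (f : lp (fun _ : ℕ => ℝ) 1) i, ‖f i • z i‖ ≤ C * |f i| := fun f i => by
    rw [norm_smul, Real.norm_eq_abs, mul_comm]
    exact mul_le_mul_of_nonneg_right (hz i) (abs_nonneg _)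
  have hsumm : ∀ f : lp (fun _ : ℕ => ℝ) 1, Summable fun i => f i • z i := fun f =>
    Summable.of_norm_bounded ((lp_one_summable f).mul_left C) (hbound f)
  let Φ : lp (fun _ : ℕ => ℝ) 1 →ₗ[ℝ] X :=
    { toFun := fun f => ∑' i, f i • z i
      map_add' := fun f g => by
        simp only [lp.coeFn_add, Pi.add_apply, add_smul]
        exact (hsumm f).tsum_add (hsumm g)
      map_smul' := fun r f => by
        simp only [lp.coeFn_smul, Pi.smul_apply, smul_assoc, RingHom.id_apply]
        exact (hsumm f).tsum_const_smul r }
  have hΦ : ∀ f, Φ f = ∑' i, f i • z i := fun f => rfl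
  have hup : ∀ f, ‖Φ f‖ ≤ C * ‖f‖ := fun f => by
    rw [hΦ, lp_one_norm, ← tsum_mul_left]
    exact tsum_of_norm_bounded ((lp_one_summable f).mul_left C).hasSum (hbound f)
  have hlow : ∀ f, c * ‖f‖ ≤ ‖Φ f‖ := fun f => by
    rw [lp_one_norm]
    exact le_of_tendsto_of_tendsto' ((lp_one_summable f).hasSum.tendsto_sum_nat.const_mul c)
      (hsumm f).hasSum.tendsto_sum_nat.norm fun n => h f n
  have hinj : Function.Injective Φ := by
    rw [← LinearMap.ker_eq_bot, LinearMap.ker_eq_bot']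
    intro f hf
    have := hlow f
    rw [hf, norm_zero] at this
    exact norm_le_zero_iff.1 (by nlinarith [norm_nonneg f])
  refine ⟨LinearMap.range Φ, ⟨(LinearEquiv.ofInjective Φ hinj).toContinuousLinearEquivOfBounds
    C c⁻¹ (fun f => hup f) fun w => ?_⟩⟩
  obtain ⟨f, rfl⟩ := (LinearEquiv.ofInjective Φ hinj).surjective w
  rw [LinearEquiv.symm_apply_apply, inv_mul_eq_div, le_div_iff₀ hc, mul_comm]
  exact hlow f

theorem separableSpace_of_schauderBasis (b : SchauderBasis ℝ X) :
    TopologicalSpace.SeparableSpace X := by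
  rw [← TopologicalSpace.isSeparable_univ_iff]
  have h1 : TopologicalSpace.IsSeparable (Submodule.span ℝ (Set.range b) : Set X) :=
    (Set.countable_range b).isSeparable.span
  refine h1.closure.mono fun x _ => ?_
  refine mem_closure_of_tendsto (SchauderBasis.tendsto_proj b x) (Filter.Eventually.of_forall ?_)
  intro n
  rw [SchauderBasis.proj_apply]
  exact Submodule.sum_mem _ fun i _ =>
    Submodule.smul_mem _ _ (Submodule.subset_span (Set.mem_range_self i))

/-- The list of indices `l` picks bounded vectors of the sequence `u` which satisfy a lower
`ℓ_1`-estimate with constant `c`. -/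
def IsL1List (u : ℕ → X) (c : ℝ) (l : List ℕ) : Prop :=
  (∀ m ∈ l, ‖u m‖ ≤ 2) ∧ ∀ a : ℕ → ℝ,
    c * ∑ j ∈ Finset.range l.length, |a j| ≤
      ‖∑ j ∈ Finset.range l.length, a j • u (l.getD j 0)‖

/-- A descending chain is a sequence of lists, each extending the one before by one entry; the
entries stabilise and define an infinite sequence equivalent to the unit vector basis. -/
theorem containsL1_of_not_wellFounded [CompleteSpace X] {u : ℕ → X} {c : ℝ} (hc : 0 < c)
    (h : ¬ WellFounded fun l' l : List ℕ => ∃ i, l' = l ++ [i] ∧ IsL1List u c l') :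
    ContainsL1 X := by
  rw [wellFounded_iff_isEmpty_descending_chain, not_isEmpty_iff] at h
  obtain ⟨f, hf⟩ := h
  choose i hfi hfL using hf
  have hlen : ∀ n, n ≤ (f n).length := fun n => by
    induction n with
    | zero => exact Nat.zero_le _
    | succ n ih => rw [hfi, List.length_append, List.length_singleton]; omega
  have hstab : ∀ m n, m ≤ n → ∀ j < (f m).length,
      j < (f n).length ∧ (f n).getD j 0 = (f m).getD j 0 := by
    intro m n hmn
    induction n, hmn using Nat.le_induction with
    | base => exact fun j hj => ⟨hj, rfl⟩
    | succ n _ ih =>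
      intro j hj
      obtain ⟨h1, h2⟩ := ih j hj
      rw [hfi n, List.length_append, List.getD_append _ _ _ _ h1]
      exact ⟨by omega, h2⟩
  have hlt : ∀ j, j < (f (j + 1)).length := fun j => hlen (j + 1)
  refine containsL1_of_sequence (z := fun j => u ((f (j + 1)).getD j 0)) (C := 2) hc ?_ ?_
  · intro j
    refine (hfL j).1 _ ?_
    rw [List.getD_eq_getElem _ _ (hlt j)]
    exact List.getElem_mem _
  · intro a n
    -- The list may be longer than `n`, so the coefficients are padded with zeros.
    have h1 := (hfL n).2 fun j => if j < n then a j else 0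
    have hsub : Finset.range n ⊆ Finset.range (f (n + 1)).length :=
      Finset.range_subset_range.2 ((Nat.le_succ n).trans (hlen (n + 1)))
    have e1 : ∑ j ∈ Finset.range (f (n + 1)).length, |if j < n then a j else 0| =
        ∑ j ∈ Finset.range n, |a j| := by
      rw [← Finset.sum_subset hsub]
      · exact Finset.sum_congr rfl fun j hj => by rw [if_pos (Finset.mem_range.1 hj)]
      · intro j _ hj
        rw [if_neg fun h => hj (Finset.mem_range.2 h), abs_zero]
    have e2 : ∑ j ∈ Finset.range (f (n + 1)).length,
          (if j < n then a j else 0) • u ((f (n + 1)).getD j 0) =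
        ∑ j ∈ Finset.range n, a j • u ((f (j + 1)).getD j 0) := by
      rw [← Finset.sum_subset hsub]
      · refine Finset.sum_congr rfl fun j hj => ?_
        have hj := Finset.mem_range.1 hj
        rw [if_pos hj, (hstab (j + 1) (n + 1) (by omega) j (hlt j)).2]
      · intro j _ hj
        rw [if_neg fun h => hj (Finset.mem_range.2 h), zero_smul]
    rwa [e1, e2] at h1

theorem sum_range_getD {M : Type*} [AddCommMonoid M] {l : List ℕ} (hl : l.Nodup)
    (f : ℕ → ℕ → M) :
    ∑ j ∈ Finset.range l.length, f j (l.getD j 0) = ∑ v ∈ l.toFinset, f (l.idxOf v) v := by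
  refine Finset.sum_bij' (ι := ℕ) (κ := ℕ) (fun j _ => l.getD j 0) (fun v _ => l.idxOf v)
    ?_ ?_ ?_ ?_ ?_
  · intro j hj
    rw [List.mem_toFinset, List.getD_eq_getElem _ _ (Finset.mem_range.1 hj)]
    exact List.getElem_mem _
  · intro v hv
    exact Finset.mem_range.2 (List.idxOf_lt_length_of_mem (List.mem_toFinset.1 hv))
  · intro j hj
    rw [List.getD_eq_getElem _ _ (Finset.mem_range.1 hj)]
    exact hl.idxOf_getElem _ _
  · intro v hv
    rw [List.getD_eq_getElem _ _ (List.idxOf_lt_length_of_mem (List.mem_toFinset.1 hv))]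
    exact List.getElem_idxOf _
  · intro j hj
    rw [List.getD_eq_getElem _ _ (Finset.mem_range.1 hj), hl.idxOf_getElem]

/-- A lower estimate on `F`, applied to multiples of the vectors of the sequence. -/
theorem LowerEstimate.sum_smul {F : Set (Finset ℕ)} (hF : Regular F) {p : Seminorm ℝ X}
    {x : ℕ → X} {δ : ℝ} (h : LowerEstimate F (pull p x) δ) {A : Finset ℕ} (hA : A ∈ F)
    (b : ℕ → ℝ) : δ * ∑ v ∈ A, p (b v • x v) ≤ p (∑ v ∈ A, b v • x v) := by
  let y : ℕ →₀ ℝ := ∑ v ∈ A, Finsupp.single v (b v)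
  have hy : ∀ v, y v = if v ∈ A then b v else 0 := fun v => by
    simp only [y, Finsupp.finsetSum_apply, Finsupp.single_apply, Finset.sum_ite_eq']
  have hcomb : comb x y = ∑ v ∈ A, b v • x v := by
    simp only [comb, y, map_sum, Finsupp.linearCombination_single]
  have hsub : y.support ⊆ A := fun v hv => by
    by_contra hvA
    exact Finsupp.mem_support_iff.1 hv (by rw [hy, if_neg hvA])
  have key := h.labelEstimate hF y id (fun _ _ _ _ h => h) (fun _ _ => le_rfl)
    (by rw [Finset.image_id]; exact hF.mono hA hsub)
  rw [Finset.image_id, pull_apply, hcomb] at key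
  refine le_trans (le_of_eq ?_) key
  congr 1
  rw [Finset.sum_subset hsub]
  · refine Finset.sum_congr rfl fun v hv => ?_
    have : (y.filter fun i => id i = v) = Finsupp.single v (b v) := by
      ext w
      rw [Finsupp.filter_apply, Finsupp.single_apply, hy]
      by_cases hvw : v = w
      · subst hvw; simp [hv]
      · rw [if_neg (fun h => hvw h.symm), if_neg hvw]
    rw [this, pull_apply, comb_single]
  · intro v _ hv
    rw [(Finsupp.filter_eq_zero_iff _ _).2, map_zero]
    intro w hw
    rw [id] at hw
    rw [hw]
    exact Finsupp.notMem_support_iff.1 hv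

/-- Small perturbation: replacing normalised vectors by terms of `u` within `c / 2` costs half of
the lower constant. -/
theorem isL1List_map {F : Set (Finset ℕ)} (hF : Regular F) {x u : ℕ → X} {c : ℝ} (hc1 : c ≤ 1)
    (hx : ∀ i, x i ≠ 0) (h : LowerEstimate F (pull (normSeminorm ℝ X) x) c) {w : ℕ → ℕ}
    (hw : ∀ i, ‖u (w i) - ‖x i‖⁻¹ • x i‖ ≤ c / 2) {l : List ℕ} (hl : l.Nodup)
    (hlF : l.toFinset ∈ F) : IsL1List u (c / 2) (l.map w) := by
  have hunit : ∀ i, ‖‖x i‖⁻¹ • x i‖ = 1 := fun i => by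
    rw [norm_smul, norm_inv, norm_norm, inv_mul_cancel₀ (norm_ne_zero_iff.2 (hx i))]
  refine ⟨fun m hm => ?_, fun a => ?_⟩
  · obtain ⟨i, -, rfl⟩ := List.mem_map.1 hm
    have h1 := norm_add_le (u (w i) - ‖x i‖⁻¹ • x i) (‖x i‖⁻¹ • x i)
    rw [sub_add_cancel, hunit] at h1
    linarith [hw i]
  · rw [List.length_map]
    have e1 : ∑ j ∈ Finset.range l.length, a j • u ((l.map w).getD j 0) =
        ∑ j ∈ Finset.range l.length, a j • u (w (l.getD j 0)) := by
      refine Finset.sum_congr rfl fun j hj => ?_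
      have hj := Finset.mem_range.1 hj
      rw [List.getD_eq_getElem _ _ hj, List.getD_eq_getElem _ _ (by simpa using hj),
        List.getElem_map]
    rw [e1, sum_range_getD hl fun j v => a j • u (w v), sum_range_getD hl fun j _ => |a j|]
    set b : ℕ → ℝ := fun v => a (l.idxOf v) with hb
    have h1 := h.sum_smul hF hlF fun v => b v * ‖x v‖⁻¹
    simp only [mul_smul, coe_normSeminorm] at h1
    have e2 : ∀ v, ‖b v • ‖x v‖⁻¹ • x v‖ = |b v| := fun v => by
      rw [norm_smul, hunit, mul_one, Real.norm_eq_abs]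
    simp only [e2] at h1
    have h2 : ‖∑ v ∈ l.toFinset, b v • (u (w v) - ‖x v‖⁻¹ • x v)‖ ≤
        c / 2 * ∑ v ∈ l.toFinset, |b v| := by
      rw [Finset.mul_sum]
      refine norm_sum_le_of_le _ fun v _ => ?_
      rw [norm_smul, Real.norm_eq_abs, mul_comm]
      exact mul_le_mul_of_nonneg_right (hw v) (abs_nonneg _)
    have h3 : ∑ v ∈ l.toFinset, b v • ‖x v‖⁻¹ • x v = ∑ v ∈ l.toFinset, b v • u (w v) -
        ∑ v ∈ l.toFinset, b v • (u (w v) - ‖x v‖⁻¹ • x v) := by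
      rw [← Finset.sum_sub_distrib]
      exact Finset.sum_congr rfl fun v _ => by rw [smul_sub, sub_sub_cancel]
    rw [h3] at h1
    have h4 := norm_sub_le (∑ v ∈ l.toFinset, b v • u (w v))
      (∑ v ∈ l.toFinset, b v • (u (w v) - ‖x v‖⁻¹ • x v))
    linarith

/-- If lower estimates with a uniform constant hold for all Schreier families, then the space
contains `ℓ_1`. -/
theorem containsL1_of_lowerEstimates [CompleteSpace X] [TopologicalSpace.SeparableSpace X]
    {a : Ordinal.{0} → ℕ → Ordinal.{0}} (ha : IsLadderSystem a) {c : ℝ} (hc : 0 < c) (hc1 : c ≤ 1)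
    (h : ∀ α < ω₁, ∃ x : ℕ → X, (∀ i, x i ≠ 0) ∧
      LowerEstimate (schreier a α) (pull (normSeminorm ℝ X) x) c) : ContainsL1 X := by
  let u := TopologicalSpace.denseSeq X
  by_contra hcon
  let R : List ℕ → List ℕ → Prop := fun l' l => ∃ i, l' = l ++ [i] ∧ IsL1List u (c / 2) l'
  have hwf : WellFounded R := by
    by_contra hR
    exact hcon (containsL1_of_not_wellFounded (half_pos hc) hR)
  have : IsWellFounded (List ℕ) R := ⟨hwf⟩
  have hrank := rank_lt_omega_one R []
  set α := IsWellFounded.rank R [] + 1 with hα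
  have hα1 : α < ω₁ := Ordinal.isPrincipal_add_omega 1 hrank
    (Ordinal.one_lt_omega0.trans Ordinal.omega0_lt_omega_one)
  obtain ⟨x, hx, hlow⟩ := h α hα1
  have hw : ∀ i, ∃ w, ‖u w - ‖x i‖⁻¹ • x i‖ ≤ c / 2 := fun i => by
    obtain ⟨w, hw⟩ := (TopologicalSpace.denseRange_denseSeq X).exists_dist_lt
      (‖x i‖⁻¹ • x i) (half_pos hc)
    exact ⟨w, by rw [← dist_eq_norm, dist_comm]; exact hw.le⟩
  choose w hw using hw
  -- The map `w` sends the tree of `S_α` into the tree of `R`, so the rank at the root is at least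
  -- `α`, although `α` was chosen one larger.
  have := le_rank_of_schreier ha hα1 0 (fun l => IsWellFounded.rank R (l.map w))
    fun l i hl _ hmem => by
      refine IsWellFounded.rank_lt_of_rel ⟨w i, by simp, ?_⟩
      exact isL1List_map (regular_schreier a α) hc1 hx hlow hw (hl.imp fun h => h.ne) hmem
  rw [hα, List.map_nil] at this
  exact absurd this (not_le.2 (lt_add_one _))

/-- Returning from an equivalent norm to the original one loses a factor depending on `α`. Only
countably many factors `1 / (n + 1)` occur, so one of them serves all countable ordinals. -/
theorem exists_deltaDDot_lt_one [CompleteSpace X] (b : SchauderBasis ℝ X)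
    {a : Ordinal.{0} → ℕ → Ordinal.{0}} (ha : IsLadderSystem a) (hl1 : ¬ ContainsL1 X) :
    ∃ α < ω₁, deltaDDot (schreier a α) b < 1 := by
  by_contra hcon
  push Not at hcon
  have hest : ∀ α < ω₁, ∃ (n : ℕ) (x : ℕ → X), IsBlockBasis b x ∧
      LowerEstimate (schreier a α) (pull (normSeminorm ℝ X) x) (1 / ((n : ℝ) + 1)) := by
    intro α hα
    obtain ⟨p, x, ⟨A, B, hA, hB, hAB⟩, hx, hlt⟩ :=
      exists_of_lt_deltaDDot ((by norm_num : (1 / 2 : ℝ) < 1).trans_le (hcon α hα))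
    have hlow := (lowerEstimate_delta (schreier a α) p x).mono_const hlt.le
    obtain ⟨n, hn⟩ := exists_nat_one_div_lt (show 0 < A / (2 * B) by positivity)
    refine ⟨n, x, hx, LowerEstimate.mono_const (fun k c hc hcF => ?_) hn.le⟩
    have h1 := hlow k c hc hcF
    have h2 := (hAB (comb x (∑ i, c i))).2
    have h3 : A * ∑ i, pull (normSeminorm ℝ X) x (c i) ≤ ∑ i, pull p x (c i) := by
      rw [Finset.mul_sum]
      exact Finset.sum_le_sum fun i _ => (hAB (comb x (c i))).1
    rw [pull_apply] at h1
    rw [pull_apply _ _ (∑ i, c i), coe_normSeminorm, div_mul_eq_mul_div, div_le_iff₀ (by positivity)]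
    linarith
  have huni : ∃ n : ℕ, ∀ α < ω₁, ∃ x : ℕ → X, IsBlockBasis b x ∧
      LowerEstimate (schreier a α) (pull (normSeminorm ℝ X) x) (1 / ((n : ℝ) + 1)) := by
    -- If every `n` failed at some `β n`, the constant found at the countable supremum would pass
    -- down to `β n` for its own `n`.
    by_contra hno
    push Not at hno
    choose β hβ hno using hno
    have hsup : (⨆ n, β n) < ω₁ := Ordinal.iSup_lt_omega_one hβ
    obtain ⟨n, x, hx, hlow⟩ := hest _ hsup
    obtain ⟨N, hN, hNS⟩ := embeds_schreier_of_le ha hsup (Ordinal.le_iSup β n)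
    exact hno n _ (hx.comp_strictMono hN) (hlow.comp_subsequence hN hNS)
  obtain ⟨n, hn⟩ := huni
  have := separableSpace_of_schauderBasis b
  refine hl1 (containsL1_of_lowerEstimates ha (c := 1 / ((n : ℝ) + 1)) (by positivity) ?_ ?_)
  · rw [div_le_one (by positivity)]
    have : (0 : ℝ) ≤ n := n.cast_nonneg
    linarith
  · intro α hα
    obtain ⟨x, hx, hlow⟩ := hn α hα
    exact ⟨x, hx.ne_zero b.linearIndependent, hlow⟩

end Embedding

/-! ### Multiplicativity and the ordinal arithmetic of the index -/

section Multiplicativity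

variable {X : Type*} [NormedAddCommGroup X] [NormedSpace ℝ X]

theorem deltaDDot_schreierZero [CompleteSpace X] (b : SchauderBasis ℝ X) :
    deltaDDot schreierZero b = 1 := by
  have hs : ∀ i, {i} ∈ schreierZero := fun i => by simp [schreierZero]
  exact le_antisymm (deltaDDot_le_one b.linearIndependent hs)
    (le_deltaDDot b.linearIndependent hs isEquivalentNorm_norm (isBlockBasis_self b) zero_le_one
      labelEstimate_schreierZero.lowerEstimate)

theorem deltaDDot_schreier_anti (b : SchauderBasis ℝ X) {a : Ordinal.{0} → ℕ → Ordinal.{0}}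
    (ha : IsLadderSystem a) {α β : Ordinal.{0}} (hβ : β < ω₁) (h : α ≤ β) :
    deltaDDot (schreier a β) b ≤ deltaDDot (schreier a α) b :=
  deltaDDot_anti b.linearIndependent (singleton_mem_schreier ha (h.trans_lt hβ))
    (embeds_schreier_of_le ha hβ h)

/-- The constants are multiplicative along multiples of an ordinal. -/
theorem deltaDDot_schreier_mul [CompleteSpace X] (b : SchauderBasis ℝ X)
    {a : Ordinal.{0} → ℕ → Ordinal.{0}} (ha : IsLadderSystem a) {α : Ordinal.{0}} (hα : α < ω₁)
    (n : ℕ) : deltaDDot (schreier a (α * n)) b = deltaDDot (schreier a α) b ^ n := by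
  rcases eq_or_ne n 0 with rfl | hn
  · rw [Nat.cast_zero, mul_zero, schreier_zero, pow_zero, deltaDDot_schreierZero]
  rcases eq_or_ne α 0 with rfl | hα0
  · rw [zero_mul, schreier_zero, deltaDDot_schreierZero, one_pow]
  have hr := regular_schreier a α
  have hs := singleton_mem_schreier ha hα
  have hs' := singleton_mem_schreier ha (mul_natCast_lt_omega_one hα n)
  exact le_antisymm
    (deltaDDot_le_pow b hr hs hn
      (embeds_iter_comp_atMostTwo ha hα (Order.one_le_iff_ne_zero.2 hα0) hn))
    (deltaDDot_pow_le b.linearIndependent hr hs' hn (embeds_schreier_mul_iter ha hα n))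

/-- Finite multiples of `σ * n + β` for an additively indecomposable `σ`. -/
theorem exists_mul_natCast_eq_of_isPrincipal {σ β : Ordinal.{0}} (hσ : IsPrincipal (· + ·) σ)
    (hβ : β < σ) {n m : ℕ} (hn : n = m + 1) (k : ℕ) :
    ∃ η < σ, (σ * n + β) * k = σ * (n * k : ℕ) + η := by
  induction k with
  | zero => exact ⟨0, bot_le.trans_lt hβ, by simp⟩
  | succ k ih =>
    obtain ⟨η, hη, h⟩ := ih
    -- Indecomposability: `η < σ` is absorbed by the first summand `σ`, which exists because `n` is
    -- positive.
    have h1 : η + σ * n = σ * n := by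
      rw [hn, Nat.add_comm, Nat.cast_add, Nat.cast_one, mul_add, mul_one, ← add_assoc,
        hσ.add_eq_right hη]
    refine ⟨β, hβ, ?_⟩
    rw [Nat.cast_succ, mul_add_one, h, Nat.mul_succ, Nat.cast_add, mul_add, add_assoc, ← add_assoc η,
      h1, add_assoc]

/-- The spectral index of a Banach space with a basis that does not contain `ℓ_1` is a power of
`ω`, and it determines the constants together with their value at the spectral index. -/
theorem spectralIndex_eq_opow_and_deltaDDot_eq [CompleteSpace X] (e : SchauderBasis ℝ X)
    {a : Ordinal.{0} → ℕ → Ordinal.{0}} (ha : IsLadderSystem a) (hl1 : ¬ ContainsL1 X) :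
    (∃ α : Ordinal.{0}, α < ω₁ ∧ spectralIndex a e = ω ^ α) ∧
    ∀ (α₀ : Ordinal.{0}) (θ : ℝ), spectralIndex a e = α₀ → deltaDDot (schreier a α₀) e = θ →
      (∀ (n : ℕ) (β : Ordinal.{0}), β < α₀ → deltaDDot (schreier a (α₀ * n + β)) e = θ ^ n) ∧
      (∀ β : Ordinal.{0}, α₀ * ω ≤ β → β < ω₁ → deltaDDot (schreier a β) e = 0) := by
  set d : Ordinal.{0} → ℝ := fun α => deltaDDot (schreier a α) e with hd
  have hd0 : ∀ α, 0 ≤ d α := fun α => deltaDDot_nonneg _ _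
  have hd1 : ∀ α < ω₁, d α ≤ 1 := fun α hα =>
    deltaDDot_le_one e.linearIndependent (singleton_mem_schreier ha hα)
  have hanti : ∀ α β, β < ω₁ → α ≤ β → d β ≤ d α := fun α β hβ h =>
    deltaDDot_schreier_anti e ha hβ h
  have hmul : ∀ α < ω₁, ∀ n : ℕ, d (α * n) = d α ^ n := fun α hα n =>
    deltaDDot_schreier_mul e ha hα n
  set σ := spectralIndex a e with hσ
  have hmem : σ < ω₁ ∧ d σ < 1 := by
    obtain ⟨α, hα, hlt⟩ := exists_deltaDDot_lt_one e ha hl1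
    exact csInf_mem (s := {α | α < ω₁ ∧ deltaDDot (schreier a α) e < 1}) ⟨α, hα, hlt⟩
  have hbelow : ∀ β < σ, d β = 1 := fun β hβ => by
    refine le_antisymm (hd1 β (hβ.trans hmem.1)) (not_lt.1 fun h => ?_)
    exact absurd hβ (not_lt.2 (csInf_le' ⟨hβ.trans hmem.1, h⟩))
  have hσ0 : σ ≠ 0 := fun h => by
    have h1 := hmem.2
    have h2 : d 0 = 1 := by
      simp only [hd]
      rw [schreier_zero, deltaDDot_schreierZero]
    rw [h, h2] at h1
    exact lt_irrefl _ h1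
  have hprinc : IsPrincipal (· + ·) σ := by
    rw [isPrincipal_add_iff_add_self_lt]
    -- If `σ ≤ η + η = η * 2`, then `d σ ≥ d η ^ 2 = 1`, which is impossible.
    intro η hη
    by_contra hcon
    have hη1 : η < ω₁ := hη.trans hmem.1
    have h1 : η * (2 : ℕ) = η + η := by
      rw [Nat.cast_ofNat, Ordinal.mul_two]
    have h2 := hmul η hη1 2
    rw [h1, hbelow η hη, one_pow] at h2
    have h3 := hanti σ (η + η) (h1 ▸ mul_natCast_lt_omega_one hη1 2) (not_lt.1 hcon)
    rw [h2] at h3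
    exact absurd hmem.2 (not_lt.2 h3)
  refine ⟨?_, ?_⟩
  · rcases isPrincipal_add_iff_zero_or_omega0_opow.1 hprinc with h | ⟨α, hα⟩
    · exact absurd h hσ0
    · have hα : ω ^ α = σ := hα
      refine ⟨α, ?_, hα.symm⟩
      exact (Ordinal.right_le_opow α Ordinal.one_lt_omega0).trans_lt (hα ▸ hmem.1)
  · rintro _ θ rfl rfl
    have hlim : ∀ n : ℕ, σ * n < ω₁ := mul_natCast_lt_omega_one hmem.1
    refine ⟨fun n β hβ => ?_, fun β hβ hβ1 => ?_⟩
    · have hle : σ * n + β ≤ σ * (n + 1 : ℕ) := by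
        rw [Nat.cast_succ, mul_add_one]
        gcongr
      have hγ : σ * n + β < ω₁ := hle.trans_lt (hlim (n + 1))
      change d (σ * n + β) = d σ ^ n
      refine le_antisymm ?_ ?_
      · rw [← hmul σ hmem.1]
        exact hanti _ _ hγ (le_self_add)
      · rcases Nat.eq_zero_or_eq_succ_pred n with rfl | hn
        · rw [pow_zero, Nat.cast_zero, mul_zero, zero_add, hbelow β hβ]
        -- `(σ * n + β) * k` is `σ * (n * k)` plus a remainder below `σ`, hence at most `σ * (n * k
        -- + 1)`.
        · have hpow : ∀ k : ℕ, d σ * (d σ ^ n) ^ k ≤ d (σ * n + β) ^ k := fun k => by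
            rw [← pow_mul, ← pow_succ', ← hmul _ hγ, ← hmul σ hmem.1]
            refine hanti _ _ (hlim _) ?_
            obtain ⟨η, hη, hk⟩ := exists_mul_natCast_eq_of_isPrincipal hprinc hβ hn k
            rw [hk, Nat.cast_succ, mul_add_one]
            gcongr
          by_contra hcon
          have hs := (hd0 (σ * n + β)).trans_lt (not_le.1 hcon)
          have hθ : 0 < d σ := (hd0 σ).lt_of_ne fun h => by
            rw [← h, hn, zero_pow (Nat.succ_ne_zero _)] at hs
            exact lt_irrefl _ hs
          -- The powers of this quotient tend to zero, but by `hpow` they stay above `d σ > 0`.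
          have hlt : d (σ * n + β) / d σ ^ n < 1 := (div_lt_one hs).2 (not_le.1 hcon)
          refine absurd (ge_of_tendsto' (tendsto_pow_atTop_nhds_zero_of_lt_one
            (div_nonneg (hd0 _) hs.le) hlt) fun k => ?_) (not_le.2 hθ)
          rw [div_pow, le_div_iff₀ (pow_pos hs k)]
          exact hpow k
    · have h1 : ∀ n : ℕ, d β ≤ d σ ^ n := fun n => by
        rw [← hmul σ hmem.1]
        refine hanti _ _ hβ1 (le_trans ?_ hβ)
        gcongr
        exact (Ordinal.natCast_lt_omega0 n).le
      exact le_antisymm (ge_of_tendsto'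
        (tendsto_pow_atTop_nhds_zero_of_lt_one (hd0 σ) hmem.2) h1) (hd0 β)

end Multiplicativity

end AsymptoticL1

end

theorem theorem4p16 {X : Type*} [NormedAddCommGroup X] [NormedSpace ℝ X] [CompleteSpace X]
    (e : SchauderBasis ℝ X)
    (a : Ordinal.{0} → ℕ → Ordinal.{0}) (ha : AsymptoticL1.IsLadderSystem a)
    (hX : AsymptoticL1.IsAsymptoticL1 e) (hl1 : ¬ AsymptoticL1.ContainsL1 X) :
    (∃ α : Ordinal.{0}, α < ω₁ ∧ AsymptoticL1.spectralIndex a e = ω ^ α) ∧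
    ∀ (α₀ : Ordinal.{0}) (θ : ℝ), AsymptoticL1.spectralIndex a e = α₀ →
      AsymptoticL1.deltaDDot (AsymptoticL1.schreier a α₀) e = θ →
      (∀ (n : ℕ) (β : Ordinal.{0}), β < α₀ →
        AsymptoticL1.deltaDDot (AsymptoticL1.schreier a (α₀ * n + β)) e = θ ^ n) ∧
      (∀ β : Ordinal.{0}, α₀ * ω ≤ β → β < ω₁ →
        AsymptoticL1.deltaDDot (AsymptoticL1.schreier a β) e = 0) :=
  AsymptoticL1.spectralIndex_eq_opow_and_deltaDDot_eq e ha hl1
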